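/- A finite hypergraph $H=(V,F)$ consists of a finite vertex set $V$ and a set $F$ of non-empty subsets (hyperedges) of $V$; its bipartite graph joins $i\in V$ and $\alpha\in F$ iff $i\in\alpha$. $H$ is connected if this bipartite graph is, and the nullity $n(H)$ is the cyclomatic number of the bipartite graph, so that $n(H)=\sum_{\alpha\in F}|\alpha|-|V|-|F|+1$ for connected $H$. Let $d_i$ be the number of hyperedges that contain $i$. For a measure space $(\mathcal X,\nu)$ and a statistic $\phi:\mathcal X\to\mathbb R^N$, put $\psi(\theta)=\log\int e^{\langle\theta,\phi\rangle}d\nu$, $\Theta=\operatorname{int}\{\theta:\psi(\theta)<\infty\}$, $p_\theta=e^{\langle\theta,\phi\rangle-\psi(\theta)}$, $Y=\{\mathbb E_{p_\theta}[\phi]:\theta\in\Theta\}$ and $\varphi(\eta)=\sup_{\theta\in\Theta}(\langle\theta,\eta\rangle-\psi(\theta))$; the exponential family is $\mathcal E=\{p_\theta:\theta\in\Theta\}$. An inference family $\mathcal I$ on $H$ consists of exponential families $\mathcal E_i$ on $(\mathcal X_i,\nu_i)$ with statistic $\phi_i$ for $i\in V$ and $\mathcal E_\alpha$ on $\prod_{i\in\alpha}(\mathcal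 X_i,\nu_i)$ with statistic $\phi_\alpha=(\phi_{\langle\alpha\rangle},(\phi_i)_{i\in\alpha})$ for $\alpha\in F$, such that all covariance matrices of $\phi_i$ under members of $\mathcal E_i$ and of $\phi_\alpha$ under members of $\mathcal E_\alpha$ are invertible, and such that for $i\in\alpha$ the marginal on $\mathcal X_i$ of each member of $\mathcal E_\alpha$ belongs to $\mathcal E_i$. Write $\eta_\alpha=(\eta_{\langle\alpha\rangle},(\eta^\alpha_i)_{i\in\alpha})$ and let $$L=\Big\{(\eta_\alpha,\eta_i)\in\prod_{\alpha}Y_\alpha\times\prod_iY_i:\ \eta^\alpha_i=\eta_i\ \text{ for all } i\in\alpha\in F\Big\}.$$ For compatibility functions $\Psi_\alpha=e^{\langle\bar\theta_\alpha,\phi_\alpha\rangle}$ the Bethe free energy is $$F(\eta)=-\sum_{\alpha}\langle\bar\theta_\alpha,\eta_\alpha\rangle+\sum_\alpha\varphi_\alpha(\eta_\alpha)+\sum_{i}(1-d_i)\varphi_i(\eta_i),\qquad \eta\in L.$$ That $F$ is convex on $L$ means that $F$ is convex on every convex subset of $L$; if $L$ is convex, this is ordinary convexity on $L$. **Theorem.**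 Let $H$ be a connected hypergraph. (i) If $n(H)\in\{0,1\}$, then for every inference family on $H$ and all $\bar\theta=(\bar\theta_\alpha)_{\alpha\in F}$, $F$ is convex on $L$. (ii) The converse holds for each of the following families and every $\bar\theta$, i.e. if $F$ is convex on $L$, then $n(H)\in\{0,1\}$: (a) multinomial inference families: each $\mathcal X_i$ is finite with at least two elements, $\nu_i$ is uniform, and $\mathcal E_i$, $\mathcal E_\alpha$ consist of all positive probability densities on $\mathcal X_i$ and on $\prod_{i\in\alpha}\mathcal X_i$; (b) the Gaussian inference family: $\mathcal X_i=\mathbb R$ with Lebesgue measure, $\phi_i=(x_i,x_i^2)$, $\phi_{\langle\alpha\rangle}=(x_ix_j)_{\{i,j\}\subseteq\alpha,\,i\ne j}$; (c) the fixed-mean Gaussian inference family for any mean vector $(\mu_i)_{i\in V}$: $\mathcal X_i=\mathbb R$ with Lebesgue measure, $\phi_i=(x_i-\mu_i)^2$, $\phi_{\langle\alpha\rangle}=((x_i-\mu_i)(x_j-\mu_j))_{\{i,j\}\subseteq\alpha,\,i\ne j}$. -/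

import Mathlib

open MeasureTheory ProbabilityTheory

namespace BetheHyper

noncomputable section

/-! ### Hypergraphs -/

/-- A finite hypergraph with vertex set the whole (finite) type `V`; its hyperedges form a set of
non-empty subsets of `V`. -/
structure FinHypergraph (V : Type*) where
  /-- the set of hyperedges -/
  edges : Finset (Finset V)
  /-- hyperedges are non-empty -/
  nonempty_of_mem : ∀ α ∈ edges, α.Nonempty

namespace FinHypergraph

variable {V : Type*} (H : FinHypergraph V)

/-- The bipartite graph of a hypergraph: a vertex `i` and a hyperedge `α` are joined
iff `i ∈ α`. -/
def bipartite : SimpleGraph (V ⊕ H.edges) :=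
  SimpleGraph.fromRel fun a b => ∃ (i : V) (α : H.edges), a = Sum.inl i ∧ b = Sum.inr α ∧ i ∈ α.1

/-- A hypergraph is connected iff its bipartite graph is. -/
def Connected : Prop := H.bipartite.Connected

/-- The number of incidences `i ∈ α`, i.e. the number of edges of the bipartite graph. -/
def numIncidences : ℕ := ∑ α ∈ H.edges, α.card

/-- The number of connected components. -/
def numComponents : ℕ := Nat.card H.bipartite.ConnectedComponent

/-- The nullity (cyclomatic number) of the bipartite graph:
number of edges, minus number of vertices, plus number of components. -/
def nullity [Fintype V] : ℤ :=
  (H.numIncidences : ℤ) - ((Fintype.card V : ℤ) + (H.edges.card : ℤ)) + (H.numComponents : ℤ)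

/-- The degree of a vertex: the number of hyperedges that contain it. -/
def degree [DecidableEq V] (i : V) : ℕ := (H.edges.filter fun α => i ∈ α).card

end FinHypergraph

/-! ### Exponential families -/

namespace ExpFamily

variable {Ω ι : Type*} [MeasurableSpace Ω] [Fintype ι] (ν : Measure Ω) (φ : Ω → ι → ℝ)

/-- The set of natural parameters: the interior of the set where the log partition function
is finite. -/
def natDomain : Set (ι → ℝ) :=
  interior {θ | Integrable (fun x => Real.exp (∑ j, θ j * φ x j)) ν}

/-- The log partition function. -/
def logPartition (θ : ι → ℝ) : ℝ :=
  Real.log (∫ x, Real.exp (∑ j, θ j * φ x j) ∂ν)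

/-- The density, with respect to the base measure `ν`, of the member with natural parameter `θ`. -/
def density (θ : ι → ℝ) (x : Ω) : ℝ :=
  Real.exp (∑ j, θ j * φ x j - logPartition ν φ θ)

/-- The probability law of the member with natural parameter `θ`. -/
def law (θ : ι → ℝ) : Measure Ω :=
  ν.withDensity fun x => ENNReal.ofReal (density ν φ θ x)

/-- The expectation parameter of the member with natural parameter `θ`. -/
def meanParam (θ : ι → ℝ) : ι → ℝ := fun j => ∫ x, φ x j ∂(law ν φ θ)

/-- The set of expectation parameters. -/
def meanDomain : Set (ι → ℝ) := meanParam ν φ '' natDomain ν φ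

/-- The covariance matrix of the sufficient statistic
(which is the Hessian of the log partition function). -/
def covMatrix (θ : ι → ℝ) : Matrix ι ι ℝ :=
  Matrix.of fun j k => covariance (fun x => φ x j) (fun x => φ x k) (law ν φ θ)

open Classical in
/-- The covariance matrix is invertible at every natural parameter. -/
def IsNondegenerate : Prop := ∀ θ ∈ natDomain ν φ, IsUnit (covMatrix ν φ θ)

/-- The Legendre transform of the log partition function. -/
def legendre (η : ι → ℝ) : ℝ :=
  sSup ((fun θ : ι → ℝ => ∑ j, θ j * η j - logPartition ν φ θ) '' natDomain ν φ)

/-- The exponential family consists of exactly all everywhere positive probability densities. -/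
def IsAllPositiveDensities : Prop :=
  {p : Ω → ℝ | ∃ θ ∈ natDomain ν φ, p = density ν φ θ} =
    {p : Ω → ℝ | (∀ x, 0 < p x) ∧ ∫ x, p x ∂ν = 1}

end ExpFamily

/-! ### Local exponential families on a hypergraph -/

universe u v w₁ w₂

/-- Base measures and sufficient statistics: a base measure `ν i` and a statistic `φV i` on the
space `X i` of each vertex, and an additional statistic `φF α` on `∏ i ∈ α, X i` for each
hyperedge. -/
structure LocalFamily {V : Type u} (H : FinHypergraph V) (X : V → Type v)
    [∀ i, MeasurableSpace (X i)] where
  /-- index type of the components of the vertex statistic -/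
  J : V → Type w₁
  /-- finitely many components -/
  fintypeJ : ∀ i, Fintype (J i)
  /-- index type of the components of the additional hyperedge statistic -/
  K : H.edges → Type w₂
  /-- finitely many components -/
  fintypeK : ∀ α, Fintype (K α)
  /-- base measure of a vertex -/
  ν : ∀ i, Measure (X i)
  /-- statistic of a vertex -/
  φV : ∀ i, X i → J i → ℝ
  /-- additional statistic of a hyperedge -/
  φF : ∀ α : H.edges, (∀ i : α.1, X i) → K α → ℝ

attribute [instance] LocalFamily.fintypeJ LocalFamily.fintypeK

namespace LocalFamily

variable {V : Type u} {H : FinHypergraph V} {X : V → Type v} [∀ i, MeasurableSpace (X i)]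
variable (I : LocalFamily.{u, v, w₁, w₂} H X)

/-- Index type of the components of the full statistic of the hyperedge `α`. -/
abbrev Idx (α : H.edges) : Type (max u w₁ w₂) := I.K α ⊕ (Σ i : α.1, I.J i)

/-- The full statistic of `α`: the additional statistic together with the statistics of
all vertices of `α`. -/
def stat (α : H.edges) (x : ∀ i : α.1, X i) : I.Idx α → ℝ :=
  Sum.elim (I.φF α x) fun p => I.φV p.1 (x p.1) p.2

/-- The base measure of `α`, the product of the base measures of its vertices. -/
def baseF (α : H.edges) : Measure (∀ i : α.1, X i) := Measure.pi fun i : α.1 => I.ν i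

/-- The local exponential families form an inference family: non-degenerate (the covariance
matrices are invertible) and closed under marginalization to a vertex. -/
structure IsInferenceFamily : Prop where
  sigmaFinite : ∀ i, SigmaFinite (I.ν i)
  ne_zero : ∀ i, I.ν i ≠ 0
  measurable_φV : ∀ i j, Measurable fun x => I.φV i x j
  measurable_φF : ∀ α k, Measurable fun x => I.φF α x k
  nondegenerateV : ∀ i, ExpFamily.IsNondegenerate (I.ν i) (I.φV i)
  nondegenerateF : ∀ α, ExpFamily.IsNondegenerate (I.baseF α) (I.stat α)
  marginallyClosed : ∀ (α : H.edges) (i : α.1),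
    ∀ θ ∈ ExpFamily.natDomain (I.baseF α) (I.stat α),
      ∃ θ' ∈ ExpFamily.natDomain (I.ν i) (I.φV i),
        (ExpFamily.law (I.baseF α) (I.stat α) θ).map (fun x => x i) =
          ExpFamily.law (I.ν i) (I.φV i) θ'

/-- Collections `(η_α, η_i)` of parameters of all hyperedges and all vertices. -/
abbrev Params : Type (max u w₁ w₂) := (∀ α : H.edges, I.Idx α → ℝ) × (∀ i, I.J i → ℝ)

/-- The set `L` of pseudomarginals: collections of expectation parameters for which the components
of `η_α` that belong to a vertex `i ∈ α` agree with `η_i`. -/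
def L : Set I.Params :=
  {η | (∀ α, η.1 α ∈ ExpFamily.meanDomain (I.baseF α) (I.stat α)) ∧
    (∀ i, η.2 i ∈ ExpFamily.meanDomain (I.ν i) (I.φV i)) ∧
    ∀ (α : H.edges) (i : α.1) (j : I.J i), η.1 α (Sum.inr ⟨i, j⟩) = η.2 i j}

/-- The Bethe free energy, where `θbar α` is the natural parameter of the compatibility function
`Ψ_α = exp ⟨θbar α, φ_α⟩`. -/
def bethe [Fintype V] [DecidableEq V] (θbar : ∀ α : H.edges, I.Idx α → ℝ) (η : I.Params) : ℝ :=
  -(∑ α, ∑ k, θbar α k * η.1 α k)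
    + ∑ α, ExpFamily.legendre (I.baseF α) (I.stat α) (η.1 α)
    + ∑ i, (1 - (H.degree i : ℝ)) * ExpFamily.legendre (I.ν i) (I.φV i) (η.2 i)

/-- Multinomial inference families (on finite spaces `X i`): the base measures are uniform, and the
exponential families of vertices and of hyperedges consist of all positive densities. -/
structure IsMultinomial : Prop where
  uniform : ∀ i, ∃ c : ENNReal, c ≠ 0 ∧ c ≠ ⊤ ∧ I.ν i = c • Measure.count
  vertex : ∀ i, ExpFamily.IsAllPositiveDensities (I.ν i) (I.φV i)
  hyperedge : ∀ α, ExpFamily.IsAllPositiveDensities (I.baseF α) (I.stat α)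

end LocalFamily

/-- The product `y i * y j` over an unordered pair `{i, j}`. -/
def pairProd {ι : Type*} (y : ι → ℝ) : Sym2 ι → ℝ :=
  Sym2.lift ⟨fun i j => y i * y j, fun i j => mul_comm (y i) (y j)⟩

/-- Fixed-mean Gaussian inference family with mean vector `m`, with Lebesgue base measure on `ℝ`:
statistics `(x_i - m_i)²` and `((x_i - m_i) * (x_j - m_j))` over unordered pairs
of distinct `i, j ∈ α`. -/
def fixedMeanGaussian {V : Type u} [DecidableEq V] (H : FinHypergraph V) (m : V → ℝ) :
    LocalFamily.{u, 0, 0, u} H (fun _ => ℝ) where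
  J _ := Unit
  fintypeJ _ := inferInstance
  K α := {s : Sym2 α.1 // ¬ s.IsDiag}
  fintypeK _ := inferInstance
  ν _ := volume
  φV i x _ := (x - m i) ^ 2
  φF _ x s := pairProd (fun i => x i - m i) s.1

/-- Gaussian inference family, with Lebesgue base measure on `ℝ`: statistics `(x_i, x_i²)` and
`(x_i * x_j)` over unordered pairs of distinct `i, j ∈ α`. -/
def gaussian {V : Type u} [DecidableEq V] (H : FinHypergraph V) :
    LocalFamily.{u, 0, 0, u} H (fun _ => ℝ) where
  J _ := Fin 2
  fintypeJ _ := inferInstance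
  K α := {s : Sym2 α.1 // ¬ s.IsDiag}
  fintypeK _ := inferInstance
  ν _ := volume
  φV _ x := ![x, x ^ 2]
  φF _ x s := pairProd x s.1

/-! ### Convexity -/

/-- `f` is convex on `S`, where `S` itself need not be convex: `f` is convex on each convex subset
of `S`. If `S` is convex, this is the usual notion, see `isConvexFunOn_iff`. -/
def IsConvexFunOn {E : Type*} [AddCommGroup E] [Module ℝ E] (S : Set E) (f : E → ℝ) : Prop :=
  ∀ C ⊆ S, Convex ℝ C → ConvexOn ℝ C f

theorem isConvexFunOn_iff {E : Type*} [AddCommGroup E] [Module ℝ E] {S : Set E}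
    (hS : Convex ℝ S) (f : E → ℝ) : IsConvexFunOn S f ↔ ConvexOn ℝ S f :=
  ⟨fun h => h S subset_rfl hS, fun h _ hC hconv => h.subset hC hconv⟩

end

end BetheHyper

namespace BetheHyper

noncomputable section

open Filter Topology

universe u v w₁ w₂

/-! Up to a linear term, the Bethe free energy on `L` is ∑ A_α + ∑ (1 - d_i) B_i, where A_α and B_i
are the Legendre transforms, that is, the negative entropies, of the local members. For a connected
hypergraph the coefficients add up to 1 - n(H) (`sum_one_sub_degree`).

If n(H) ≤ 1, the terms with negative coefficients can be absorbed. For i ∈ α the difference A_α -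
B_i is convex: its Bregman divergence is the relative entropy of two laws on α minus that of their
marginals at i, which is nonnegative by data processing (`legendre_sub_legendre_tangent_le`). The
bipartite graph has at most one edge outside a spanning tree, so its edges can be oriented such that
every node is the head of at most one of them (`exists_injective_endpoint`). Let A_α absorb B_i when
the incidence of i and α points to α. Each A_α absorbs at most one B_i, and B_i is absorbed at least
d_i - 1 times, so what remains of it has a nonnegative coefficient. This writes the free energy as a
sum of convex functions (`bethe_convex`).

Conversely, take affine paths in `L` along which the variables become completely dependent in a
limit, so that every local entropy varies like that of a single variable. The differences between
midpoint and chord of all A_α and B_i then tend to the same κ < 0, and that of the free energy to (1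
- n(H)) κ. Convexity makes this nonpositive, so n(H) ≤ 1 (`nullity_le_one_of_path`); n(H) ≥ 0
follows from connectedness. In the multinomial case the paths are mixtures of two configurations,
smoothed by a uniform part of weight δ → 0. In the Gaussian cases the covariance is ε I + t J with J
the all-ones matrix and ε → 0; the negative entropy on k variables is -½ log (ε + k t) plus a term
free of t. -/

/-- If `E[exp (-Z)] ≤ 1` then `E[Z] ≥ 0`. -/
theorem integral_nonneg_of_integral_exp_neg_le_one {Ω : Type*} [MeasurableSpace Ω] {P : Measure Ω}
    [IsProbabilityMeasure P] {Z : Ω → ℝ} (hZ : Integrable Z P)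
    (hE : Integrable (fun x => Real.exp (-Z x)) P) (h : ∫ x, Real.exp (-Z x) ∂P ≤ 1) :
    0 ≤ ∫ x, Z x ∂P := by
  have h1 : ∫ x, (1 - Z x) ∂P ≤ ∫ x, Real.exp (-Z x) ∂P :=
    integral_mono ((integrable_const 1).sub hZ) hE fun x => by
      have := Real.add_one_le_exp (-Z x)
      simp only
      linarith
  rw [integral_sub (integrable_const 1) hZ] at h1
  simp at h1
  linarith

/-! ### Exponential families: integrability, Gibbs' inequality, Legendre transform -/

namespace ExpFamily

variable {Ω ι : Type*} [MeasurableSpace Ω] [Fintype ι] {ν : Measure Ω} {φ : Ω → ι → ℝ}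

theorem integrable_of_mem_natDomain {θ : ι → ℝ} (hθ : θ ∈ natDomain ν φ) :
    Integrable (fun x => Real.exp (∑ j, θ j * φ x j)) ν := by
  have := interior_subset hθ
  exact this

theorem density_pos (θ : ι → ℝ) (x : Ω) : 0 < density ν φ θ x := Real.exp_pos _

theorem log_density (θ : ι → ℝ) (x : Ω) :
    Real.log (density ν φ θ x) = ∑ j, θ j * φ x j - logPartition ν φ θ := Real.log_exp _

theorem measurable_density (hφ : ∀ j, Measurable fun x => φ x j) (θ : ι → ℝ) :
    Measurable (density ν φ θ) := by
  unfold density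
  fun_prop

theorem integrable_density {θ : ι → ℝ} (hθ : θ ∈ natDomain ν φ) :
    Integrable (density ν φ θ) ν := by
  have : density ν φ θ =
      fun x => Real.exp (∑ j, θ j * φ x j) * Real.exp (-logPartition ν φ θ) := by
    funext x
    rw [density, sub_eq_add_neg, Real.exp_add]
  rw [this]
  exact (integrable_of_mem_natDomain hθ).mul_const _

theorem integral_exp_pos_of_ne_zero (hν : ν ≠ 0) {θ : ι → ℝ} (hθ : θ ∈ natDomain ν φ) :
    0 < ∫ x, Real.exp (∑ j, θ j * φ x j) ∂ν := by
  have : NeZero ν := ⟨hν⟩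
  exact integral_exp_pos (integrable_of_mem_natDomain hθ)

theorem exp_logPartition (hν : ν ≠ 0) {θ : ι → ℝ} (hθ : θ ∈ natDomain ν φ) :
    Real.exp (logPartition ν φ θ) = ∫ x, Real.exp (∑ j, θ j * φ x j) ∂ν :=
  Real.exp_log (integral_exp_pos_of_ne_zero hν hθ)

theorem integral_density (hν : ν ≠ 0) {θ : ι → ℝ} (hθ : θ ∈ natDomain ν φ) :
    ∫ x, density ν φ θ x ∂ν = 1 := by
  simp_rw [density, Real.exp_sub]
  rw [integral_div, exp_logPartition hν hθ, div_self (integral_exp_pos_of_ne_zero hν hθ).ne']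

theorem isProbabilityMeasure_law (hν : ν ≠ 0) {θ : ι → ℝ} (hθ : θ ∈ natDomain ν φ) :
    IsProbabilityMeasure (law ν φ θ) := by
  constructor
  rw [law, withDensity_apply _ MeasurableSet.univ, setLIntegral_univ,
    ← ofReal_integral_eq_lintegral_ofReal (integrable_density hθ)
      (Filter.Eventually.of_forall fun x => (density_pos θ x).le), integral_density hν hθ,
    ENNReal.ofReal_one]

theorem integral_law (hφ : ∀ j, Measurable fun x => φ x j) (θ : ι → ℝ) (g : Ω → ℝ) :
    ∫ x, g x ∂(law ν φ θ) = ∫ x, density ν φ θ x * g x ∂ν := by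
  rw [law, integral_withDensity_eq_integral_toReal_smul
    (measurable_density hφ θ).ennreal_ofReal (by simp)]
  simp [ENNReal.toReal_ofReal (density_pos _ _).le]

theorem integrable_law_iff (hφ : ∀ j, Measurable fun x => φ x j) (θ : ι → ℝ) (g : Ω → ℝ) :
    Integrable g (law ν φ θ) ↔ Integrable (fun x => density ν φ θ x * g x) ν := by
  rw [law, integrable_withDensity_iff_integrable_smul'
    (measurable_density hφ θ).ennreal_ofReal (by simp)]
  simp [ENNReal.toReal_ofReal (density_pos _ _).le]

/-- The natural domain is open, so θ can be moved both ways along coordinate j. This gives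
exponential moments of φ_j of both signs, which dominate |φ_j|. -/
theorem integrable_stat (hφ : ∀ j, Measurable fun x => φ x j) {θ : ι → ℝ}
    (hθ : θ ∈ natDomain ν φ) (j : ι) : Integrable (fun x => φ x j) (law ν φ θ) := by
  classical
  have hcont : Continuous fun s : ℝ => θ + s • (Pi.single j 1 : ι → ℝ) := by fun_prop
  have hopen : IsOpen ((fun s : ℝ => θ + s • (Pi.single j 1 : ι → ℝ)) ⁻¹' natDomain ν φ) :=
    isOpen_interior.preimage hcont
  obtain ⟨r, hr, hball⟩ := Metric.isOpen_iff.1 hopen 0 (by simpa using hθ)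
  have hmem : ∀ s : ℝ, |s| < r → Integrable (fun x => Real.exp (s * φ x j)) (law ν φ θ) := by
    intro s hs
    have h1 : θ + s • (Pi.single j 1 : ι → ℝ) ∈ natDomain ν φ :=
      hball (by simpa [Metric.mem_ball] using hs)
    rw [integrable_law_iff hφ]
    refine ((integrable_of_mem_natDomain h1).mul_const
      (Real.exp (-logPartition ν φ θ))).congr (Filter.Eventually.of_forall fun x => ?_)
    simp only [density]
    rw [← Real.exp_add, ← Real.exp_add]
    congr 1
    simp [add_mul, Finset.sum_add_distrib, Pi.single_apply]
    ring
  have hp := hmem (r / 2) (by rw [abs_of_pos (by positivity)]; linarith)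
  have hm := hmem (-(r / 2)) (by rw [abs_neg, abs_of_pos (by positivity)]; linarith)
  refine ((hp.add hm).const_mul (2 / r)).mono' (hφ j).aestronglyMeasurable
    (Filter.Eventually.of_forall fun x => ?_)
  have e1 := Real.add_one_le_exp (r / 2 * φ x j)
  have e2 := Real.add_one_le_exp (-(r / 2) * φ x j)
  have e3 := Real.exp_pos (r / 2 * φ x j)
  have e4 := Real.exp_pos (-(r / 2) * φ x j)
  simp only [Pi.add_apply, Real.norm_eq_abs]
  rw [div_mul_eq_mul_div, le_div_iff₀ hr]
  rcases abs_cases (φ x j) with ⟨h, -⟩ | ⟨h, -⟩ <;> rw [h] <;> nlinarith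

theorem integrable_linear_stat (hφ : ∀ j, Measurable fun x => φ x j) {θ : ι → ℝ}
    (hθ : θ ∈ natDomain ν φ) (t : ι → ℝ) :
    Integrable (fun x => ∑ j, t j * φ x j) (law ν φ θ) :=
  integrable_finsetSum _ fun j _ => (integrable_stat hφ hθ j).const_mul _

theorem integral_linear_stat (hφ : ∀ j, Measurable fun x => φ x j) {θ : ι → ℝ}
    (hθ : θ ∈ natDomain ν φ) (t : ι → ℝ) :
    ∫ x, ∑ j, t j * φ x j ∂(law ν φ θ) = ∑ j, t j * meanParam ν φ θ j := by
  rw [integral_finsetSum _ fun j _ => (integrable_stat hφ hθ j).const_mul _]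
  simp_rw [integral_const_mul, meanParam]

theorem integrable_log_density (hν : ν ≠ 0) (hφ : ∀ j, Measurable fun x => φ x j) {θ : ι → ℝ}
    (hθ : θ ∈ natDomain ν φ) (θ' : ι → ℝ) :
    Integrable (fun x => Real.log (density ν φ θ' x)) (law ν φ θ) := by
  have := isProbabilityMeasure_law hν hθ
  simp_rw [log_density]
  exact (integrable_linear_stat hφ hθ θ').sub (integrable_const _)

theorem integral_log_density (hν : ν ≠ 0) (hφ : ∀ j, Measurable fun x => φ x j) {θ : ι → ℝ}
    (hθ : θ ∈ natDomain ν φ) (θ' : ι → ℝ) :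
    ∫ x, Real.log (density ν φ θ' x) ∂(law ν φ θ) =
      ∑ j, θ' j * meanParam ν φ θ j - logPartition ν φ θ' := by
  have := isProbabilityMeasure_law hν hθ
  simp_rw [log_density]
  rw [integral_sub (integrable_linear_stat hφ hθ θ') (integrable_const _),
    integral_linear_stat hφ hθ]
  simp

/-- Gibbs' inequality within an exponential family. -/
theorem gibbs (hν : ν ≠ 0) (hφ : ∀ j, Measurable fun x => φ x j) {θ θ' : ι → ℝ}
    (hθ : θ ∈ natDomain ν φ) (hθ' : θ' ∈ natDomain ν φ) :
    ∑ j, θ' j * meanParam ν φ θ j - logPartition ν φ θ' ≤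
      ∑ j, θ j * meanParam ν φ θ j - logPartition ν φ θ := by
  have := isProbabilityMeasure_law hν hθ
  have h1 := integrable_log_density hν hφ hθ θ
  have h2 := integrable_log_density hν hφ hθ θ'
  -- For Z the log-likelihood ratio of θ to θ', weighting exp (-Z) by the density of θ gives the
  -- density of θ', of total mass one.
  have key : ∀ x, density ν φ θ x *
      Real.exp (-(Real.log (density ν φ θ x) - Real.log (density ν φ θ' x))) =
        density ν φ θ' x := fun x => by
    rw [neg_sub, Real.exp_sub, Real.exp_log (density_pos _ _), Real.exp_log (density_pos _ _),
      mul_div_cancel₀ _ (density_pos _ _).ne']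
  have := integral_nonneg_of_integral_exp_neg_le_one (h1.sub h2)
    ((integrable_law_iff hφ _ _).2 (by
      simpa only [Pi.sub_apply, key] using integrable_density hθ'))
    (by
      rw [integral_law hφ]
      simp only [Pi.sub_apply, key]
      exact (integral_density hν hθ').le)
  simp only [Pi.sub_apply] at this
  rw [integral_sub h1 h2, integral_log_density hν hφ hθ, integral_log_density hν hφ hθ] at this
  linarith

theorem legendre_meanParam (hν : ν ≠ 0) (hφ : ∀ j, Measurable fun x => φ x j) {θ : ι → ℝ}
    (hθ : θ ∈ natDomain ν φ) :
    legendre ν φ (meanParam ν φ θ) = ∑ j, θ j * meanParam ν φ θ j - logPartition ν φ θ := by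
  refine IsGreatest.csSup_eq ⟨⟨θ, hθ, rfl⟩, ?_⟩
  rintro _ ⟨τ, hτ, rfl⟩
  exact gibbs hν hφ hθ hτ

/-- The Legendre transform at a mean parameter is the negative entropy. -/
theorem legendre_meanParam_eq_integral (hν : ν ≠ 0) (hφ : ∀ j, Measurable fun x => φ x j)
    {θ : ι → ℝ} (hθ : θ ∈ natDomain ν φ) :
    legendre ν φ (meanParam ν φ θ) = ∫ x, density ν φ θ x * Real.log (density ν φ θ x) ∂ν := by
  rw [← integral_law hφ, integral_log_density hν hφ hθ, legendre_meanParam hν hφ hθ]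

/-- The Legendre transform lies above its tangents at mean parameters. -/
theorem legendre_tangent_le (hν : ν ≠ 0) (hφ : ∀ j, Measurable fun x => φ x j) {θ θ' : ι → ℝ}
    (hθ : θ ∈ natDomain ν φ) (hθ' : θ' ∈ natDomain ν φ) :
    legendre ν φ (meanParam ν φ θ) + ∑ j, θ j * (meanParam ν φ θ' j - meanParam ν φ θ j) ≤
      legendre ν φ (meanParam ν φ θ') := by
  rw [legendre_meanParam hν hφ hθ, legendre_meanParam hν hφ hθ']
  have := gibbs hν hφ hθ' hθ
  simp_rw [mul_sub, Finset.sum_sub_distrib]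
  linarith

end ExpFamily

/-! ### Orientations of graphs with at most one cycle -/

/-- The edges of a finite tree can be oriented away from a root, such that each vertex is the head
of at most one edge and the root of none. -/
theorem exists_injective_endpoint_of_isTree {W : Type*} [Finite W] {T : SimpleGraph W}
    (hT : T.IsTree) (r : W) :
    ∃ o : T.edgeSet → W, Function.Injective o ∧ ∀ e, o e ∈ e.1 ∧ o e ≠ r := by
  classical
  -- The parent of w is the next vertex on a shortest walk to r.
  have hstep : ∀ w : {w // w ≠ r}, ∃ p, T.Adj w.1 p ∧ T.dist r p < T.dist r w.1 := by
    rintro ⟨w, hw⟩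
    obtain ⟨q, hq⟩ := hT.connected.exists_walk_length_eq_dist w r
    cases q with
    | nil => exact absurd rfl hw
    | cons h q =>
      refine ⟨_, h, ?_⟩
      rw [T.dist_comm, T.dist_comm (u := r), ← hq, SimpleGraph.Walk.length_cons]
      exact Nat.lt_succ_of_le (SimpleGraph.dist_le q)
  choose p hadj hdist using hstep
  let e : {w // w ≠ r} → T.edgeSet := fun w => ⟨s(w.1, p w), hadj w⟩
  -- Two vertices with the same parent edge would be each other's parents, but distance to the root
  -- drops strictly.
  have he : Function.Injective e := by
    intro w w' h
    have h' : s(w.1, p w) = s(w'.1, p w') := congrArg Subtype.val h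
    rcases Sym2.eq_iff.1 h' with ⟨h1, -⟩ | ⟨h1, h2⟩
    · exact Subtype.ext h1
    · have a := hdist w
      have b := hdist w'
      rw [h2] at a
      rw [← h1] at b
      omega
  -- A tree has as many edges as non-root vertices, so every edge is a parent edge; its head is the
  -- child.
  have hcard : Nat.card {w // w ≠ r} = Nat.card T.edgeSet := by
    have := Fintype.ofFinite W
    have h1 := (SimpleGraph.isTree_iff_connected_and_card.1 hT).2
    have h2 : Nat.card {w // w ≠ r} = Nat.card W - 1 := by
      simp [Nat.card_eq_fintype_card, Fintype.card_subtype_compl]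
    omega
  have hbij : Function.Bijective e := (Nat.bijective_iff_injective_and_card e).2 ⟨he, hcard⟩
  let E := Equiv.ofBijective e hbij
  refine ⟨fun x => (E.symm x).1, Subtype.val_injective.comp E.symm.injective, fun x => ⟨?_, ?_⟩⟩
  · have h : e (E.symm x) = x := E.apply_symm_apply x
    have h' : s((E.symm x).1, p (E.symm x)) = x.1 := congrArg Subtype.val h
    rw [← h']
    exact Sym2.mem_mk_left _ _
  · exact (E.symm x).2

/-- The edges of a finite connected graph with at most one cycle can be oriented
such that no vertex is the head of two edges. -/
theorem exists_injective_endpoint {W : Type*} [Finite W] {G : SimpleGraph W} (hG : G.Connected)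
    (hcard : Nat.card G.edgeSet ≤ Nat.card W) :
    ∃ o : G.edgeSet → W, Function.Injective o ∧ ∀ e, o e ∈ e.1 := by
  classical
  obtain ⟨T, hTG, hT⟩ := hG.exists_isTree_le
  have h1 := (SimpleGraph.isTree_iff_connected_and_card.1 hT).2
  have hsub : T.edgeSet ⊆ G.edgeSet := SimpleGraph.edgeSet_mono hTG
  have hdiff : (G.edgeSet \ T.edgeSet).ncard ≤ 1 := by
    have h3 := Set.ncard_sdiff_add_ncard_of_subset hsub
    rw [← Nat.card_coe_set_eq T.edgeSet, ← Nat.card_coe_set_eq G.edgeSet] at h3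
    omega
  have huniq : ∀ a ∈ G.edgeSet \ T.edgeSet, ∀ b ∈ G.edgeSet \ T.edgeSet, a = b :=
    fun a ha b hb => (Set.ncard_le_one (Set.toFinite _)).1 hdiff a ha b hb
  -- The tree is rooted at an endpoint of the extra edge, if there is one. The root is the head of
  -- no tree edge and is free to be the head of the extra one.
  have hroot : ∃ r : W, ∀ e ∈ G.edgeSet \ T.edgeSet, r ∈ e := by
    by_cases h : (G.edgeSet \ T.edgeSet).Nonempty
    · obtain ⟨e, he⟩ := h
      induction e using Sym2.ind with
      | _ a b =>
        exact ⟨a, fun e' he' => huniq _ he _ he' ▸ Sym2.mem_mk_left a b⟩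
    · obtain ⟨r⟩ := hG.nonempty
      exact ⟨r, fun e he => absurd ⟨e, he⟩ h⟩
  obtain ⟨r, hr⟩ := hroot
  obtain ⟨o, ho, hoe⟩ := exists_injective_endpoint_of_isTree hT r
  refine ⟨fun e => if h : e.1 ∈ T.edgeSet then o ⟨e.1, h⟩ else r, ?_, ?_⟩
  · intro e e' h
    by_cases h1 : e.1 ∈ T.edgeSet <;> by_cases h2 : e'.1 ∈ T.edgeSet <;>
      simp only [h1, h2, dif_pos, dif_neg, not_false_eq_true] at h
    · exact Subtype.ext (Subtype.mk.inj (ho h))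
    · exact absurd h (hoe _).2
    · exact absurd h.symm (hoe _).2
    · exact Subtype.ext (huniq _ ⟨e.2, h1⟩ _ ⟨e'.2, h2⟩)
  · intro e
    by_cases h1 : e.1 ∈ T.edgeSet
    · simpa only [h1, dif_pos] using (hoe ⟨e.1, h1⟩).1
    · simpa only [h1, dif_neg, not_false_eq_true] using hr e.1 ⟨e.2, h1⟩

/-! ### Nullity, degrees and the assignment of vertices to hyperedges -/

namespace FinHypergraph

variable {V : Type*} (H : FinHypergraph V)

theorem bipartite_adj_inl_inr {i : V} {α : H.edges} :
    H.bipartite.Adj (Sum.inl i) (Sum.inr α) ↔ i ∈ α.1 := by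
  simp [bipartite, SimpleGraph.fromRel_adj]

/-- The edges of the bipartite graph are the incidences. -/
def incidenceEquiv : (Σ α : H.edges, α.1) ≃ H.bipartite.edgeSet :=
  Equiv.ofBijective
    (fun p => ⟨s(Sum.inl p.2.1, Sum.inr p.1), H.bipartite_adj_inl_inr.2 p.2.2⟩) <| by
    constructor
    · rintro ⟨α, i, hi⟩ ⟨β, j, hj⟩ h
      have h' := congrArg Subtype.val h
      simp only [Sym2.eq_iff, Sum.inl.injEq, Sum.inr.injEq, reduceCtorEq, and_self, or_false] at h'
      obtain ⟨rfl, rfl⟩ := h'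
      rfl
    · rintro ⟨e, he⟩
      induction e using Sym2.ind with
      | _ a b =>
        obtain ⟨-, ⟨i, α, rfl, rfl, hi⟩ | ⟨i, α, rfl, rfl, hi⟩⟩ :=
          (SimpleGraph.fromRel_adj _ _ _).1 ((SimpleGraph.mem_edgeSet _).1 he)
        · exact ⟨⟨α, i, hi⟩, rfl⟩
        · exact ⟨⟨α, i, hi⟩, Subtype.ext Sym2.eq_swap⟩

theorem card_edgeSet_bipartite : Nat.card H.bipartite.edgeSet = H.numIncidences := by
  rw [← Nat.card_congr H.incidenceEquiv, Nat.card_sigma, numIncidences]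
  simp only [Nat.card_eq_fintype_card, Fintype.card_coe]
  exact Finset.sum_coe_sort H.edges Finset.card

variable {H} [Fintype V]

theorem nullity_eq_of_connected (hH : H.Connected) :
    H.nullity = (H.numIncidences : ℤ) - (Fintype.card V + H.edges.card) + 1 := by
  have : Subsingleton H.bipartite.ConnectedComponent :=
    hH.preconnected.subsingleton_connectedComponent
  have : Nonempty H.bipartite.ConnectedComponent := hH.nonempty.map H.bipartite.connectedComponentMk
  rw [nullity, numComponents, Nat.card_unique]
  simp

theorem card_bipartite : Nat.card (V ⊕ H.edges) = Fintype.card V + H.edges.card := by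
  simp

theorem nullity_nonneg_of_connected (hH : H.Connected) : 0 ≤ H.nullity := by
  have h := SimpleGraph.Connected.card_vert_le_card_edgeSet_add_one hH
  rw [card_edgeSet_bipartite, card_bipartite] at h
  rw [nullity_eq_of_connected hH]
  omega

theorem nullity_eq_zero_or_one_of_le (hH : H.Connected) (h : H.nullity ≤ 1) :
    H.nullity = 0 ∨ H.nullity = 1 := by
  have := nullity_nonneg_of_connected hH
  omega

theorem sum_degree [DecidableEq V] : ∑ i, H.degree i = H.numIncidences := by
  simp_rw [degree, numIncidences, Finset.card_filter]
  rw [Finset.sum_comm]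
  simp

/-- Double counting of incidences. The left side is the total coefficient of the local negative
entropies in the Bethe free energy. -/
theorem sum_one_sub_degree [DecidableEq V] (hH : H.Connected) :
    (H.edges.card : ℝ) + ∑ i, (1 - (H.degree i : ℝ)) = 1 - H.nullity := by
  rw [nullity_eq_of_connected hH, Finset.sum_sub_distrib, ← Nat.cast_sum, sum_degree]
  simp
  ring

/-- In a connected hypergraph with at most one cycle, each hyperedge `α` can be given at most one of
its vertices such that each vertex `i` is given to all but at most one of the hyperedges
that contain it. -/
theorem exists_assignment [DecidableEq V] (hH : H.Connected) (h : H.nullity ≤ 1) :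
    ∃ f : H.edges → Option V, (∀ α, ∀ i ∈ f α, i ∈ α.1) ∧
      ∀ i, H.degree i ≤ 1 + (Finset.univ.filter fun α => f α = some i).card := by
  classical
  have hc : Nat.card H.bipartite.edgeSet ≤ Nat.card (V ⊕ H.edges) := by
    rw [nullity_eq_of_connected hH] at h
    rw [card_edgeSet_bipartite, card_bipartite]
    omega
  obtain ⟨o, ho, hoe⟩ := exists_injective_endpoint hH hc
  let g : (Σ α : H.edges, α.1) → V ⊕ H.edges := fun p => o (H.incidenceEquiv p)
  have hg : Function.Injective g := ho.comp H.incidenceEquiv.injective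
  have hgm : ∀ p, g p = Sum.inl p.2.1 ∨ g p = Sum.inr p.1 := fun p => by
    have : g p ∈ s(Sum.inl p.2.1, Sum.inr p.1) := hoe (H.incidenceEquiv p)
    exact Sym2.mem_iff.1 this
  -- The vertex whose incidence with α has head α; it is unique because `g` is injective.
  let f : H.edges → Option V := fun α =>
    if h : ∃ i : α.1, g ⟨α, i⟩ = Sum.inr α then some h.choose.1 else none
  have hf : ∀ α, ∀ i : α.1, g ⟨α, i⟩ = Sum.inr α → f α = some i.1 := fun α i hi => by
    have hex : ∃ i : α.1, g ⟨α, i⟩ = Sum.inr α := ⟨i, hi⟩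
    have h1 : f α = some hex.choose.1 := dif_pos hex
    have h2 := hg (hex.choose_spec.trans hi.symm)
    have h3 : hex.choose = i := by simpa using h2
    rw [h1, h3]
  refine ⟨f, fun α i hi => ?_, fun i => ?_⟩
  · by_cases hex : ∃ i : α.1, g ⟨α, i⟩ = Sum.inr α
    · have h1 : f α = some hex.choose.1 := dif_pos hex
      rw [h1] at hi
      obtain rfl := Option.some.inj hi
      exact hex.choose.2
    · have h1 : f α = none := dif_neg hex
      simp [h1] at hi
  · have hdeg : H.degree i = (Finset.univ.filter fun α : H.edges => i ∈ α.1).card := by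
      rw [degree, Finset.card_filter, Finset.card_filter, ← Finset.sum_coe_sort]
    rw [hdeg, ← Finset.card_filter_add_card_filter_not (fun α => f α ≠ some i),
      Finset.filter_filter, Finset.filter_filter]
    refine add_le_add (Finset.card_le_one.2 ?_) (Finset.card_le_card fun α => ?_)
    -- An incidence of i with a hyperedge that is not assigned i has head i, and there is at most
    -- one such incidence.
    · intro α hα β hβ
      simp only [Finset.mem_filter, Finset.mem_univ, true_and] at hα hβ
      have h1 := (hgm ⟨α, i, hα.1⟩).resolve_right fun h => hα.2 (hf α ⟨i, hα.1⟩ h)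
      have h2 := (hgm ⟨β, i, hβ.1⟩).resolve_right fun h => hβ.2 (hf β ⟨i, hβ.1⟩ h)
      exact congrArg Sigma.fst (hg (h1.trans h2.symm))
    · simp

end FinHypergraph

/-! ### Convexity of the Bethe free energy for nullity at most one -/

/-- A function with a supporting affine function at every point of a convex set is convex there. -/
theorem convexOn_of_exists_support {E : Type*} [AddCommGroup E] [Module ℝ E] {C : Set E}
    (hC : Convex ℝ C) {f : E → ℝ}
    (h : ∀ x ∈ C, ∃ s : E →ₗ[ℝ] ℝ, ∀ y ∈ C, f x + s (y - x) ≤ f y) : ConvexOn ℝ C f := by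
  refine ⟨hC, fun x hx y hy a b ha hb hab => ?_⟩
  obtain ⟨s, hs⟩ := h _ (hC hx hy ha hb hab)
  have h1 := hs x hx
  have h2 := hs y hy
  have h3 : a • s (x - (a • x + b • y)) + b • s (y - (a • x + b • y)) = 0 := by
    rw [← map_smul, ← map_smul, ← map_add]
    have : a • (x - (a • x + b • y)) + b • (y - (a • x + b • y)) = 0 := by
      obtain rfl : b = 1 - a := by linarith
      module
    rw [this, map_zero]
  simp only [smul_eq_mul] at h3 ⊢
  have h4 := add_le_add (mul_le_mul_of_nonneg_left h1 ha) (mul_le_mul_of_nonneg_left h2 hb)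
  have h5 : (a + b) * f (a • x + b • y) = f (a • x + b • y) := by rw [hab, one_mul]
  linarith

theorem convexOn_finsetSum {E κ : Type*} [AddCommGroup E] [Module ℝ E] {C : Set E}
    (hC : Convex ℝ C) (s : Finset κ) {f : κ → E → ℝ} (h : ∀ k ∈ s, ConvexOn ℝ C (f k)) :
    ConvexOn ℝ C fun x => ∑ k ∈ s, f k x := by
  classical
  induction s using Finset.induction_on with
  | empty => simpa using convexOn_const 0 hC
  | insert a s ha ih =>
    simp_rw [Finset.sum_insert ha]
    exact (h a (Finset.mem_insert_self a s)).add
      (ih fun k hk => h k (Finset.mem_insert_of_mem hk))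

namespace LocalFamily

variable {V : Type u} {H : FinHypergraph V} {X : V → Type v} [∀ i, MeasurableSpace (X i)]
variable {I : LocalFamily.{u, v, w₁, w₂} H X}

theorem measurable_stat (hI : I.IsInferenceFamily) (α : H.edges) (k : I.Idx α) :
    Measurable fun x => I.stat α x k := by
  rcases k with k | ⟨i, j⟩
  · exact hI.measurable_φF α k
  · exact (hI.measurable_φV i j).comp (measurable_pi_apply i)

theorem baseF_ne_zero (hI : I.IsInferenceFamily) (α : H.edges) : I.baseF α ≠ 0 := by
  have := hI.sigmaFinite
  intro h
  have h1 : I.baseF α Set.univ = 0 := by rw [h]; rfl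
  rw [baseF, Measure.pi_univ, Finset.prod_eq_zero_iff] at h1
  obtain ⟨i, -, hi⟩ := h1
  exact hI.ne_zero i (Measure.measure_univ_eq_zero.1 hi)

variable (I) in
/-- The marginal to a vertex of a vector of parameters of a hyperedge. -/
def marginal (α : H.edges) (i : α.1) (η : I.Idx α → ℝ) : I.J i → ℝ :=
  fun j => η (Sum.inr ⟨i, j⟩)

theorem marginal_meanParam (hI : I.IsInferenceFamily) {α : H.edges} {i : α.1}
    {θ : I.Idx α → ℝ} {θ' : I.J i → ℝ}
    (h : (ExpFamily.law (I.baseF α) (I.stat α) θ).map (fun x => x i) =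
      ExpFamily.law (I.ν i) (I.φV i) θ') :
    I.marginal α i (ExpFamily.meanParam (I.baseF α) (I.stat α) θ) =
      ExpFamily.meanParam (I.ν i) (I.φV i) θ' := by
  funext j
  rw [marginal, ExpFamily.meanParam, ExpFamily.meanParam, ← h,
    integral_map (measurable_pi_apply i).aemeasurable (hI.measurable_φV i j).aestronglyMeasurable]
  rfl

open ExpFamily in
/-- Data processing inequality: the relative entropy of two members of the family of a hyperedge is
at least that of their marginals. -/
theorem legendre_sub_legendre_tangent_le (hI : I.IsInferenceFamily) {α : H.edges} {i : α.1}
    {θ θ₁ : I.Idx α → ℝ} {τ τ₁ : I.J i → ℝ}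
    (hθ₁ : θ₁ ∈ natDomain (I.baseF α) (I.stat α)) (hτ₁ : τ₁ ∈ natDomain (I.ν i) (I.φV i))
    (h : (law (I.baseF α) (I.stat α) θ).map (fun x => x i) = law (I.ν i) (I.φV i) τ)
    (h₁ : (law (I.baseF α) (I.stat α) θ₁).map (fun x => x i) = law (I.ν i) (I.φV i) τ₁) :
    ∑ j, τ₁ j * meanParam (I.ν i) (I.φV i) τ₁ j - logPartition (I.ν i) (I.φV i) τ₁ -
        (∑ j, τ j * meanParam (I.ν i) (I.φV i) τ₁ j - logPartition (I.ν i) (I.φV i) τ) ≤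
      ∑ k, θ₁ k * meanParam (I.baseF α) (I.stat α) θ₁ k - logPartition (I.baseF α) (I.stat α) θ₁ -
        (∑ k, θ k * meanParam (I.baseF α) (I.stat α) θ₁ k -
          logPartition (I.baseF α) (I.stat α) θ) := by
  have hb := baseF_ne_zero hI α
  have hs := measurable_stat hI α
  have hν := hI.ne_zero i
  have hφ := hI.measurable_φV i
  have hpi : Measurable fun x : ∀ i : α.1, X i => x i := measurable_pi_apply i
  have := isProbabilityMeasure_law hb hθ₁
  set p := density (I.baseF α) (I.stat α) θ with hp
  set p₁ := density (I.baseF α) (I.stat α) θ₁ with hp₁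
  set q := density (I.ν i) (I.φV i) τ with hq
  set q₁ := density (I.ν i) (I.φV i) τ₁ with hq₁
  have i1 : Integrable (fun x => Real.log (p₁ x)) _ := integrable_log_density hb hs hθ₁ θ₁
  have i2 : Integrable (fun x => Real.log (p x)) _ := integrable_log_density hb hs hθ₁ θ
  have i3 : Integrable (fun y => Real.log (q₁ y)) _ := integrable_log_density hν hφ hτ₁ τ₁
  have i4 : Integrable (fun y => Real.log (q y)) _ := integrable_log_density hν hφ hτ₁ τ
  rw [← integral_log_density hν hφ hτ₁ τ₁, ← integral_log_density hν hφ hτ₁ τ,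
    ← integral_log_density hb hs hθ₁ θ₁, ← integral_log_density hb hs hθ₁ θ]
  rw [← h₁] at i3 i4
  rw [← h₁, integral_map hpi.aemeasurable i3.aestronglyMeasurable,
    integral_map hpi.aemeasurable i4.aestronglyMeasurable]
  replace i3 := i3.comp_measurable hpi
  replace i4 := i4.comp_measurable hpi
  -- With Z = log (p₁ / p) - log (q₁ / q), the function p₁ exp (-Z) is p reweighted to have marginal
  -- q₁ at i. Its mass is one because q is the marginal of p.
  have key : ∀ x, p₁ x * Real.exp (-((Real.log (p₁ x) - Real.log (p x)) -
      (Real.log (q₁ (x i)) - Real.log (q (x i))))) = p x * (q₁ (x i) / q (x i)) := fun x => by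
    have e1 : 0 < p₁ x := density_pos _ _
    have e2 : 0 < p x := density_pos _ _
    have e3 : 0 < q₁ (x i) := density_pos _ _
    have e4 : 0 < q (x i) := density_pos _ _
    rw [show -((Real.log (p₁ x) - Real.log (p x)) - (Real.log (q₁ (x i)) - Real.log (q (x i)))) =
      (Real.log (p x) - Real.log (p₁ x)) + (Real.log (q₁ (x i)) - Real.log (q (x i))) by ring,
      Real.exp_add, Real.exp_sub, Real.exp_sub, Real.exp_log e1, Real.exp_log e2, Real.exp_log e3,
      Real.exp_log e4]
    field_simp
  have key2 : ∀ y, q y * (q₁ y / q y) = q₁ y := fun y =>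
    mul_div_cancel₀ _ (density_pos (ν := I.ν i) (φ := I.φV i) τ y).ne'
  have j1 : Integrable (fun y => q₁ y / q y) (law (I.ν i) (I.φV i) τ) :=
    (integrable_law_iff hφ _ _).2 (by
      rw [← hq]
      simp_rw [key2]
      exact integrable_density hτ₁)
  have j2 : ∫ y, q₁ y / q y ∂(law (I.ν i) (I.φV i) τ) = 1 := by
    rw [integral_law hφ, ← hq]
    simp_rw [key2]
    exact integral_density hν hτ₁
  rw [← h] at j1 j2
  rw [integral_map hpi.aemeasurable j1.aestronglyMeasurable, integral_law hs, ← hp] at j2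
  replace j1 := (integrable_law_iff hs _ _).1 (j1.comp_measurable hpi)
  rw [← hp] at j1
  have i12 := i1.sub i2
  have i34 := i3.sub i4
  have := integral_nonneg_of_integral_exp_neg_le_one (i12.sub i34)
    ((integrable_law_iff hs _ _).2 (by
      rw [← hp₁]
      simpa only [Pi.sub_apply, Function.comp_apply, key] using j1))
    (by
      rw [integral_law hs, ← hp₁]
      simp only [Pi.sub_apply, Function.comp_apply, key]
      exact j2.le)
  rw [integral_sub' i12 i34, integral_sub' i1 i2, integral_sub' i3 i4] at this
  simp only [Function.comp_apply] at this
  linarith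

/-- Pairing with a vector of parameters, as a linear functional. -/
def pairing {κ : Type*} [Fintype κ] (θ : κ → ℝ) : (κ → ℝ) →ₗ[ℝ] ℝ :=
  ∑ k, θ k • LinearMap.proj k

theorem pairing_apply {κ : Type*} [Fintype κ] (θ η : κ → ℝ) :
    pairing θ η = ∑ k, θ k * η k := by
  simp [pairing, LinearMap.sum_apply]

/-- The natural parameter of the member with mean η_i is the slope of a supporting functional at η.
-/
theorem convexOn_legendre_vertex (hI : I.IsInferenceFamily) {C : Set I.Params} (hC : Convex ℝ C)
    (hCL : C ⊆ I.L) (i : V) :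
    ConvexOn ℝ C fun η => ExpFamily.legendre (I.ν i) (I.φV i) (η.2 i) := by
  refine convexOn_of_exists_support hC fun η hη => ?_
  obtain ⟨θ, hθ, e⟩ := (hCL hη).2.1 i
  refine ⟨pairing θ ∘ₗ LinearMap.proj i ∘ₗ LinearMap.snd ℝ _ _, fun η' hη' => ?_⟩
  obtain ⟨θ', hθ', e'⟩ := (hCL hη').2.1 i
  have := ExpFamily.legendre_tangent_le (hI.ne_zero i) (hI.measurable_φV i) hθ hθ'
  rw [e, e'] at this
  simpa [pairing_apply] using this

theorem convexOn_legendre_hyperedge (hI : I.IsInferenceFamily) {C : Set I.Params} (hC : Convex ℝ C)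
    (hCL : C ⊆ I.L) (α : H.edges) :
    ConvexOn ℝ C fun η => ExpFamily.legendre (I.baseF α) (I.stat α) (η.1 α) := by
  refine convexOn_of_exists_support hC fun η hη => ?_
  obtain ⟨θ, hθ, e⟩ := (hCL hη).1 α
  refine ⟨pairing θ ∘ₗ LinearMap.proj α ∘ₗ LinearMap.fst ℝ _ _, fun η' hη' => ?_⟩
  obtain ⟨θ', hθ', e'⟩ := (hCL hη').1 α
  have := ExpFamily.legendre_tangent_le (baseF_ne_zero hI α) (measurable_stat hI α) hθ hθ'
  rw [e, e'] at this
  simpa [pairing_apply] using this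

/-- The negative conditional entropy of a hyperedge given one of its vertices is convex. -/
theorem convexOn_legendre_sub (hI : I.IsInferenceFamily) {C : Set I.Params} (hC : Convex ℝ C)
    (hCL : C ⊆ I.L) (α : H.edges) (i : α.1) :
    ConvexOn ℝ C fun η => ExpFamily.legendre (I.baseF α) (I.stat α) (η.1 α) -
      ExpFamily.legendre (I.ν i) (I.φV i) (η.2 i) := by
  -- Closure under marginalization gives a vertex member, and the consistency condition of `L`
  -- identifies its mean with η_i.
  have hvert : ∀ η ∈ C, ∀ θ ∈ ExpFamily.natDomain (I.baseF α) (I.stat α),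
      ExpFamily.meanParam (I.baseF α) (I.stat α) θ = η.1 α →
      ∃ τ ∈ ExpFamily.natDomain (I.ν i) (I.φV i),
        (ExpFamily.law (I.baseF α) (I.stat α) θ).map (fun x => x i) =
          ExpFamily.law (I.ν i) (I.φV i) τ ∧
        ExpFamily.meanParam (I.ν i) (I.φV i) τ = η.2 i := by
    intro η hη θ hθ e
    obtain ⟨τ, hτ, h⟩ := hI.marginallyClosed α i θ hθ
    refine ⟨τ, hτ, h, ?_⟩
    rw [← marginal_meanParam hI h, e]
    funext j
    exact (hCL hη).2.2 α i j
  refine convexOn_of_exists_support hC fun η hη => ?_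
  obtain ⟨θ, hθ, e⟩ := (hCL hη).1 α
  obtain ⟨τ, hτ, h, eτ⟩ := hvert η hη θ hθ e
  refine ⟨pairing θ ∘ₗ LinearMap.proj α ∘ₗ LinearMap.fst ℝ _ _ -
    pairing τ ∘ₗ LinearMap.proj i.1 ∘ₗ LinearMap.snd ℝ _ _, fun η' hη' => ?_⟩
  obtain ⟨θ', hθ', e'⟩ := (hCL hη').1 α
  obtain ⟨τ', hτ', h', eτ'⟩ := hvert η' hη' θ' hθ' e'
  have key := legendre_sub_legendre_tangent_le hI hθ' hτ' h h'
  rw [← e, ← e', ← eτ, ← eτ',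
    ExpFamily.legendre_meanParam (baseF_ne_zero hI α) (measurable_stat hI α) hθ,
    ExpFamily.legendre_meanParam (baseF_ne_zero hI α) (measurable_stat hI α) hθ',
    ExpFamily.legendre_meanParam (hI.ne_zero i) (hI.measurable_φV i) hτ,
    ExpFamily.legendre_meanParam (hI.ne_zero i) (hI.measurable_φV i) hτ']
  simp only [LinearMap.sub_apply, LinearMap.comp_apply, LinearMap.fst_apply, LinearMap.snd_apply,
    LinearMap.proj_apply, map_sub, pairing_apply,
    ← e, ← e', ← eτ, ← eτ']
  linarith

variable [Fintype V] [DecidableEq V]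

theorem bethe_convex (hI : I.IsInferenceFamily) (hH : H.Connected) (hn : H.nullity ≤ 1)
    (θbar : ∀ α : H.edges, I.Idx α → ℝ) : IsConvexFunOn I.L (I.bethe θbar) := by
  intro C hCL hC
  obtain ⟨f, hfmem, hfdeg⟩ := FinHypergraph.exists_assignment hH hn
  let Λ : I.Params →ₗ[ℝ] ℝ :=
    -∑ α, pairing (θbar α) ∘ₗ LinearMap.proj α ∘ₗ LinearMap.fst ℝ _ _
  let A : H.edges → I.Params → ℝ := fun α η => ExpFamily.legendre (I.baseF α) (I.stat α) (η.1 α)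
  let B : V → I.Params → ℝ := fun i η => ExpFamily.legendre (I.ν i) (I.φV i) (η.2 i)
  let S : H.edges → I.Params → ℝ := fun α η => ∑ i, if f α = some i then B i η else 0
  have hS : ∀ α, ConvexOn ℝ C fun η => A α η - S α η := by
    intro α
    cases hα : f α with
    | none =>
      have : (fun η => A α η - S α η) = A α := by
        funext η
        simp [S, hα]
      rw [this]
      exact convexOn_legendre_hyperedge hI hC hCL α
    | some i =>
      have : (fun η => A α η - S α η) = fun η => A α η - B i η := by
        funext η
        simp [S, hα]
      rw [this]
      exact convexOn_legendre_sub hI hC hCL α ⟨i, hfmem α i hα⟩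
  -- Subtracting the assigned B_i inside the hyperedge terms raises the coefficient of B_i by the
  -- number of hyperedges assigned i.
  have hF : I.bethe θbar = fun η => Λ η + ∑ α, (A α η - S α η) +
      ∑ i, (1 + ((Finset.univ.filter fun α => f α = some i).card : ℝ) - H.degree i) * B i η := by
    funext η
    have hsum : ∑ α, S α η =
        ∑ i, ((Finset.univ.filter fun α => f α = some i).card : ℝ) * B i η := by
      rw [Finset.sum_comm]
      refine Finset.sum_congr rfl fun i _ => ?_
      rw [← Finset.sum_filter, Finset.sum_const, nsmul_eq_mul]
    rw [Finset.sum_sub_distrib, hsum]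
    have hΛ : Λ η = -(∑ α, ∑ k, θbar α k * η.1 α k) := by
      simp [Λ, LinearMap.sum_apply, pairing_apply]
    rw [hΛ, bethe]
    have : ∀ i, (1 + ((Finset.univ.filter fun α => f α = some i).card : ℝ) - H.degree i) * B i η =
        (1 - (H.degree i : ℝ)) * B i η +
          ((Finset.univ.filter fun α => f α = some i).card : ℝ) * B i η := fun i => by ring
    simp_rw [this]
    rw [Finset.sum_add_distrib]
    ring
  rw [hF]
  have hsum1 : ConvexOn ℝ C fun η => ∑ α, (A α η - S α η) :=
    convexOn_finsetSum hC _ fun α _ => hS α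
  have hsum2 : ConvexOn ℝ C fun η => ∑ i,
      (1 + ((Finset.univ.filter fun α => f α = some i).card : ℝ) - H.degree i) * B i η := by
    refine convexOn_finsetSum hC _ fun i _ => (convexOn_legendre_vertex hI hC hCL i).smul ?_
    have : (H.degree i : ℝ) ≤ 1 + ((Finset.univ.filter fun α => f α = some i).card : ℝ) := by
      exact_mod_cast hfdeg i
    linarith
  exact ((Λ.convexOn hC).add hsum1).add hsum2

end LocalFamily

/-! ### The converse: paths along which all local entropies behave alike -/

namespace LocalFamily

variable {V : Type u} {H : FinHypergraph V} {X : V → Type v} [∀ i, MeasurableSpace (X i)]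
variable {I : LocalFamily.{u, v, w₁, w₂} H X}
variable [Fintype V] [DecidableEq V]

/-- Along an affine path of pseudomarginals, a convex Bethe free energy lies below its chord
at the midpoint; the linear part cancels. -/
theorem midpoint_difference_nonpos {θbar : ∀ α : H.edges, I.Idx α → ℝ}
    (h : IsConvexFunOn I.L (I.bethe θbar)) {η : ℝ → I.Params}
    (haff : ∀ s t a b : ℝ, a + b = 1 → η (a * s + b * t) = a • η s + b • η t)
    {s t : ℝ} (hst : s ≤ t) (hL : ∀ r ∈ Set.Icc s t, η r ∈ I.L) :
    ∑ α, (ExpFamily.legendre (I.baseF α) (I.stat α) ((η ((s + t) / 2)).1 α) -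
        (ExpFamily.legendre (I.baseF α) (I.stat α) ((η s).1 α) +
          ExpFamily.legendre (I.baseF α) (I.stat α) ((η t).1 α)) / 2) +
      ∑ i, (1 - (H.degree i : ℝ)) * (ExpFamily.legendre (I.ν i) (I.φV i) ((η ((s + t) / 2)).2 i) -
        (ExpFamily.legendre (I.ν i) (I.φV i) ((η s).2 i) +
          ExpFamily.legendre (I.ν i) (I.φV i) ((η t).2 i)) / 2) ≤ 0 := by
  have hC : segment ℝ (η s) (η t) ⊆ I.L := by
    rintro _ ⟨a, b, ha, hb, hab, rfl⟩
    rw [← haff s t a b hab]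
    exact hL _ (convex_Icc s t (Set.left_mem_Icc.2 hst) (Set.right_mem_Icc.2 hst) ha hb hab)
  have h1 := (h _ hC (convex_segment _ _)).2 (left_mem_segment ℝ _ _) (right_mem_segment ℝ _ _)
    (show (0 : ℝ) ≤ 1 / 2 by norm_num) (show (0 : ℝ) ≤ 1 / 2 by norm_num) (by norm_num)
  have hmid : η ((s + t) / 2) = (1 / 2 : ℝ) • η s + (1 / 2 : ℝ) • η t := by
    rw [← haff s t _ _ (by norm_num)]
    congr 1
    ring
  rw [← hmid] at h1
  have hlin : ∑ α, ∑ k, θbar α k * (η ((s + t) / 2)).1 α k =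
      1 / 2 * ∑ α, ∑ k, θbar α k * (η s).1 α k + 1 / 2 * ∑ α, ∑ k, θbar α k * (η t).1 α k := by
    rw [hmid]
    simp_rw [Finset.mul_sum, ← Finset.sum_add_distrib]
    refine Finset.sum_congr rfl fun α _ => Finset.sum_congr rfl fun k _ => ?_
    simp only [Prod.fst_add, Prod.smul_fst, Pi.add_apply, Pi.smul_apply, smul_eq_mul]
    ring
  simp only [bethe, smul_eq_mul] at h1
  rw [hlin] at h1
  simp only [mul_sub, mul_add, add_div, mul_div_assoc', Finset.sum_sub_distrib,
    Finset.sum_add_distrib, ← Finset.sum_div] at h1 ⊢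
  linarith

/-- If there are affine paths of pseudomarginals along which the midpoint differences of all local
negative entropies tend to the same negative number, then convexity of the Bethe free energy
bounds the nullity by one. -/
theorem nullity_le_one_of_path (hH : H.Connected) {θbar : ∀ α : H.edges, I.Idx α → ℝ}
    (h : IsConvexFunOn I.L (I.bethe θbar)) {η : ℝ → ℝ → I.Params}
    (haff : ∀ δ s t a b : ℝ, a + b = 1 → η δ (a * s + b * t) = a • η δ s + b • η δ t)
    {s t : ℝ} (hst : s ≤ t) (hL : ∀ δ ∈ Set.Ioo (0 : ℝ) 1, ∀ r ∈ Set.Icc s t, η δ r ∈ I.L)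
    {A : H.edges → ℝ → ℝ → ℝ} {B : V → ℝ → ℝ → ℝ}
    (hA : ∀ α, ∀ δ ∈ Set.Ioo (0 : ℝ) 1, ∀ r ∈ Set.Icc s t,
      ExpFamily.legendre (I.baseF α) (I.stat α) ((η δ r).1 α) = A α δ r)
    (hB : ∀ i, ∀ δ ∈ Set.Ioo (0 : ℝ) 1, ∀ r ∈ Set.Icc s t,
      ExpFamily.legendre (I.ν i) (I.φV i) ((η δ r).2 i) = B i δ r)
    {κ : ℝ} (hκ : κ < 0)
    (hAlim : ∀ α, Tendsto (fun δ => A α δ ((s + t) / 2) - (A α δ s + A α δ t) / 2)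
      (𝓝[>] 0) (𝓝 κ))
    (hBlim : ∀ i, Tendsto (fun δ => B i δ ((s + t) / 2) - (B i δ s + B i δ t) / 2)
      (𝓝[>] 0) (𝓝 κ)) : H.nullity ≤ 1 := by
  have hlim : Tendsto (fun δ => ∑ α, (A α δ ((s + t) / 2) - (A α δ s + A α δ t) / 2) +
      ∑ i, (1 - (H.degree i : ℝ)) * (B i δ ((s + t) / 2) - (B i δ s + B i δ t) / 2)) (𝓝[>] 0)
      (𝓝 (∑ _α : H.edges, κ + ∑ i, (1 - (H.degree i : ℝ)) * κ)) :=
    (tendsto_finsetSum _ fun α _ => hAlim α).add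
      (tendsto_finsetSum _ fun i _ => (hBlim i).const_mul _)
  have hle : ∑ _α : H.edges, κ + ∑ i, (1 - (H.degree i : ℝ)) * κ ≤ 0 := by
    refine le_of_tendsto hlim ?_
    filter_upwards [Ioo_mem_nhdsGT (zero_lt_one' ℝ)] with δ hδ
    have h1 : s ∈ Set.Icc s t := ⟨le_rfl, hst⟩
    have h2 : t ∈ Set.Icc s t := ⟨hst, le_rfl⟩
    have h3 : (s + t) / 2 ∈ Set.Icc s t := ⟨by linarith, by linarith⟩
    have := midpoint_difference_nonpos h (haff δ) hst (hL δ hδ)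
    simpa only [hA _ δ hδ _ h1, hA _ δ hδ _ h2, hA _ δ hδ _ h3, hB _ δ hδ _ h1, hB _ δ hδ _ h2,
      hB _ δ hδ _ h3] using this
  -- The limit equals (1 - n) κ, and κ < 0.
  rw [← Finset.sum_mul, Finset.sum_const, Finset.card_univ, Fintype.card_coe, nsmul_eq_mul,
    ← add_mul, FinHypergraph.sum_one_sub_degree hH] at hle
  have : (H.nullity : ℝ) ≤ 1 := by nlinarith
  exact_mod_cast this

end LocalFamily

/-! ### Multinomial families -/

/-- All atoms have mass w, so the law P has density P / w, which is a member because all positive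
densities are. The division by w also shifts the negative entropy by -log w. -/
theorem ExpFamily.moment_mem_and_legendre {Ω ι : Type*} [MeasurableSpace Ω]
    [MeasurableSingletonClass Ω] [Fintype Ω] [Fintype ι] {ν : Measure Ω} {φ : Ω → ι → ℝ}
    (h : IsAllPositiveDensities ν φ) {w : ℝ} (hw : 0 < w) (hν : ∀ x, ν.real {x} = w)
    [IsFiniteMeasure ν] {P : Ω → ℝ} (hP : ∀ x, 0 < P x) (hsum : ∑ x, P x = 1) :
    (fun j => ∑ x, P x * φ x j) ∈ meanDomain ν φ ∧
      legendre ν φ (fun j => ∑ x, P x * φ x j) = ∑ x, P x * Real.log (P x) - Real.log w := by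
  have hφ : ∀ j, Measurable fun x => φ x j := fun j => measurable_of_finite _
  have hint : ∀ f : Ω → ℝ, ∫ x, P x / w * f x ∂ν = ∑ x, P x * f x := fun f => by
    rw [integral_fintype .of_finite]
    refine Finset.sum_congr rfl fun x _ => ?_
    rw [hν, smul_eq_mul]
    field_simp
  have hmem : (fun x => P x / w) ∈ {p : Ω → ℝ | (∀ x, 0 < p x) ∧ ∫ x, p x ∂ν = 1} :=
    ⟨fun x => div_pos (hP x) hw, by simpa [hsum] using hint fun _ => 1⟩
  rw [← h] at hmem
  obtain ⟨θ, hθ, e⟩ := hmem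
  have hmean : meanParam ν φ θ = fun j => ∑ x, P x * φ x j := by
    funext j
    rw [meanParam, integral_law hφ, ← e, ← hint]
  have hν0 : ν ≠ 0 := by
    rintro rfl
    have : Nonempty Ω := by
      by_contra hne
      rw [not_nonempty_iff] at hne
      simp at hsum
    obtain ⟨x⟩ := this
    have := hν x
    simp at this
    linarith
  refine ⟨⟨θ, hθ, hmean⟩, ?_⟩
  rw [← hmean, legendre_meanParam_eq_integral hν0 hφ hθ, ← e, hint]
  simp_rw [fun x => Real.log_div (hP x).ne' hw.ne', mul_sub]
  rw [Finset.sum_sub_distrib, ← Finset.sum_mul, hsum, one_mul]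

section Mix

variable {Ω : Type*} [Fintype Ω] [DecidableEq Ω]

/-- A mixture of point masses at `a` and `b` and, with weight `δ`, the uniform distribution. -/
def mix (a b : Ω) (δ t : ℝ) (x : Ω) : ℝ :=
  (1 - δ) * (t * (if x = a then 1 else 0) + (1 - t) * (if x = b then 1 else 0)) +
    δ * (Fintype.card Ω : ℝ)⁻¹

theorem sum_mix_mul (a b : Ω) (δ t : ℝ) (f : Ω → ℝ) :
    ∑ x, mix a b δ t x * f x =
      (1 - δ) * (t * f a + (1 - t) * f b) + δ * ((Fintype.card Ω : ℝ)⁻¹ * ∑ x, f x) := by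
  have : ∀ x, mix a b δ t x * f x = (1 - δ) * (t * (if x = a then f x else 0) +
      (1 - t) * (if x = b then f x else 0)) + δ * ((Fintype.card Ω : ℝ)⁻¹ * f x) := fun x => by
    rw [mix]
    split_ifs <;> ring
  simp_rw [this, Finset.sum_add_distrib, ← Finset.mul_sum, Finset.sum_add_distrib,
    ← Finset.mul_sum]
  simp

theorem sum_mix (a b : Ω) (δ t : ℝ) : ∑ x, mix a b δ t x = 1 := by
  have h := sum_mix_mul a b δ t fun _ => 1
  have : Nonempty Ω := ⟨a⟩
  have hc : (Fintype.card Ω : ℝ) ≠ 0 := by exact_mod_cast Fintype.card_ne_zero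
  simp only [mul_one, Finset.sum_const, Finset.card_univ, nsmul_eq_mul] at h
  rw [h, inv_mul_cancel₀ hc]
  ring

theorem mix_pos (a b : Ω) {δ t : ℝ} (hδ : δ ∈ Set.Ioo (0 : ℝ) 1) (ht : t ∈ Set.Icc (0 : ℝ) 1)
    (x : Ω) : 0 < mix a b δ t x := by
  have : Nonempty Ω := ⟨a⟩
  have hc : (0 : ℝ) < Fintype.card Ω := by exact_mod_cast Fintype.card_pos
  have h1 : 0 ≤ 1 - δ := by linarith [hδ.2]
  have h2 : 0 ≤ 1 - t := by linarith [ht.2]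
  have h3 := ht.1
  have h4 := hδ.1
  unfold mix
  have : 0 < δ * (Fintype.card Ω : ℝ)⁻¹ := by positivity
  have : 0 ≤ (1 - δ) * (t * (if x = a then 1 else 0) + (1 - t) * (if x = b then 1 else 0)) := by
    split_ifs <;> positivity
  linarith

/-- At δ = 0 only the atoms t and 1 - t remain, with negative entropy -log 2 at t = 1/2 and 0 at
both ends; y log y is continuous at 0 and c cancels. -/
theorem tendsto_sum_mix_mul_log {a b : Ω} (hab : a ≠ b) (c : ℝ) :
    Tendsto (fun δ => (∑ x, mix a b δ ((0 + 1) / 2) x * Real.log (mix a b δ ((0 + 1) / 2) x) - c) -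
      ((∑ x, mix a b δ 0 x * Real.log (mix a b δ 0 x) - c) +
        (∑ x, mix a b δ 1 x * Real.log (mix a b δ 1 x) - c)) / 2) (𝓝[>] 0)
      (𝓝 (-Real.log 2)) := by
  have hcont : ∀ t, Continuous fun δ => ∑ x, mix a b δ t x * Real.log (mix a b δ t x) := by
    intro t
    refine continuous_finsetSum _ fun x _ => ?_
    refine Real.continuous_mul_log.comp (g := fun y : ℝ => y * Real.log y) ?_
    unfold mix
    fun_prop
  have h0 : ∀ t, (∑ x, mix a b 0 t x * Real.log (mix a b 0 t x)) =
      t * Real.log t + (1 - t) * Real.log (1 - t) := by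
    intro t
    have : ∀ x, mix a b 0 t x * Real.log (mix a b 0 t x) =
        (if x = a then t * Real.log t else 0) +
          if x = b then (1 - t) * Real.log (1 - t) else 0 := by
      intro x
      by_cases h1 : x = a
      · have h2 : x ≠ b := fun h2 => hab (h1.symm.trans h2)
        have : a ≠ b := hab
        simp [mix, h1, this]
      · by_cases h2 : x = b <;> simp [mix, h1, h2, hab.symm]
    simp_rw [this, Finset.sum_add_distrib]
    simp
  have hc : Continuous fun δ =>
      (∑ x, mix a b δ ((0 + 1) / 2) x * Real.log (mix a b δ ((0 + 1) / 2) x) - c) -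
      ((∑ x, mix a b δ 0 x * Real.log (mix a b δ 0 x) - c) +
        (∑ x, mix a b δ 1 x * Real.log (mix a b δ 1 x) - c)) / 2 :=
    ((hcont _).sub continuous_const).sub
      ((((hcont _).sub continuous_const).add ((hcont _).sub continuous_const)).div_const _)
  have := (hc.tendsto 0).mono_left (nhdsWithin_le_nhds (s := Set.Ioi 0))
  simp only [h0] at this
  convert this using 2
  rw [show (1 : ℝ) - (0 + 1) / 2 = 2⁻¹ by norm_num, show ((0 : ℝ) + 1) / 2 = 2⁻¹ by norm_num,
    Real.log_inv]
  simp
  ring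

end Mix

/-- Uniform laws on products have uniform marginals, which makes the smoothed mixtures consistent at
the vertices. -/
theorem average_pi_apply {κ : Type*} [Fintype κ] [DecidableEq κ] {Y : κ → Type*}
    [∀ i, Fintype (Y i)] [∀ i, Nonempty (Y i)] (i : κ) (f : Y i → ℝ) :
    (Fintype.card (∀ i, Y i) : ℝ)⁻¹ * ∑ x : ∀ i, Y i, f (x i) =
      (Fintype.card (Y i) : ℝ)⁻¹ * ∑ y, f y := by
  let F : ∀ k, Y k → ℝ := Function.update (fun _ _ => 1) i f
  have hF : ∀ x : ∀ i, Y i, f (x i) = ∏ k, F k (x k) := fun x => by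
    rw [Finset.prod_eq_single i (fun k _ hk => by simp [F, Function.update_of_ne hk]) (by simp)]
    simp [F]
  have hne : ∀ k, (Fintype.card (Y k) : ℝ) ≠ 0 := fun k => by
    exact_mod_cast Fintype.card_ne_zero
  simp_rw [hF]
  rw [← Fintype.prod_sum, Fintype.card_pi, Nat.cast_prod, ← Finset.prod_inv_distrib,
    ← Finset.prod_mul_distrib]
  rw [Finset.prod_eq_single i (fun k _ hk => by
    simp [F, Function.update_of_ne hk, hne k]) (by simp)]
  simp [F]

namespace LocalFamily

variable {V : Type u} {H : FinHypergraph V} {X : V → Type v} [∀ i, MeasurableSpace (X i)]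
variable {I : LocalFamily.{u, v, w₁, w₂} H X}
variable [Fintype V] [DecidableEq V]

/-- The path moves mass from a configuration b to a configuration a that differs from it at every
vertex. The restrictions to each (non-empty) hyperedge are then distinct, so every local term has
the limit -log 2. -/
theorem nullity_le_one_of_isMultinomial [∀ i, MeasurableSingletonClass (X i)] [∀ i, Finite (X i)]
    [∀ i, Nontrivial (X i)] (hH : H.Connected) (hI : I.IsMultinomial)
    {θbar : ∀ α : H.edges, I.Idx α → ℝ} (h : IsConvexFunOn I.L (I.bethe θbar)) :
    H.nullity ≤ 1 := by
  classical
  have := fun i => Fintype.ofFinite (X i)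
  choose c hc0 hctop hc using hI.uniform
  choose a b hab using fun i => exists_pair_ne (X i)
  have hfin : ∀ i, IsFiniteMeasure (I.ν i) := fun i => by
    rw [hc]
    exact Measure.smul_finite _ (hctop i)
  have hfinF : ∀ α, IsFiniteMeasure (I.baseF α) := fun α => by
    unfold baseF
    infer_instance
  have hcpos : ∀ i, 0 < (c i).toReal := fun i => ENNReal.toReal_pos (hc0 i) (hctop i)
  have hνV : ∀ i x, (I.ν i).real {x} = (c i).toReal := fun i x => by
    simp [hc, Measure.real]
  have hνF : ∀ α x, (I.baseF α).real {x} = ∏ i : α.1, (c i).toReal := fun α x => by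
    rw [Measure.real, baseF, Measure.pi_singleton, ENNReal.toReal_prod]
    simp [hc]
  let aF : ∀ α : H.edges, ∀ i : α.1, X i := fun α i => a i
  let bF : ∀ α : H.edges, ∀ i : α.1, X i := fun α i => b i
  have habF : ∀ α, aF α ≠ bF α := fun α e => by
    obtain ⟨i, hi⟩ := H.nonempty_of_mem α.1 α.2
    exact hab i (congrFun e ⟨i, hi⟩)
  have hmF := fun (α : H.edges) δ (hδ : δ ∈ Set.Ioo (0 : ℝ) 1) r (hr : r ∈ Set.Icc (0 : ℝ) 1) =>
    ExpFamily.moment_mem_and_legendre (hI.hyperedge α)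
      (Finset.prod_pos fun (i : α.1) _ => hcpos i) (hνF α) (mix_pos (aF α) (bF α) hδ hr)
      (sum_mix _ _ _ _)
  have hmV := fun i δ (hδ : δ ∈ Set.Ioo (0 : ℝ) 1) r (hr : r ∈ Set.Icc (0 : ℝ) 1) =>
    ExpFamily.moment_mem_and_legendre (hI.vertex i) (hcpos i) (hνV i)
      (mix_pos (a i) (b i) hδ hr) (sum_mix _ _ _ _)
  refine nullity_le_one_of_path hH h
    (η := fun δ t => (fun α k => ∑ x, mix (aF α) (bF α) δ t x * I.stat α x k,
      fun i j => ∑ x, mix (a i) (b i) δ t x * I.φV i x j))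
    ?_ zero_le_one ?_ (fun α δ hδ r hr => (hmF α δ hδ r hr).2)
    (fun i δ hδ r hr => (hmV i δ hδ r hr).2) (neg_neg_of_pos (Real.log_pos one_lt_two))
    (fun α => tendsto_sum_mix_mul_log (habF α) _) (fun i => tendsto_sum_mix_mul_log (hab i) _)
  · intro δ s t p q hpq
    obtain rfl : q = 1 - p := by linarith
    refine Prod.ext ?_ ?_
    · funext α k
      simp only [Prod.fst_add, Prod.smul_fst, Pi.add_apply, Pi.smul_apply, smul_eq_mul, sum_mix_mul]
      ring
    · funext i j
      simp only [Prod.snd_add, Prod.smul_snd, Pi.add_apply, Pi.smul_apply, smul_eq_mul, sum_mix_mul]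
      ring
  · intro δ hδ r hr
    refine ⟨fun α => (hmF α δ hδ r hr).1, fun i => (hmV i δ hδ r hr).1, fun α i j => ?_⟩
    simp only [sum_mix_mul, stat, Sum.elim_inr]
    rw [average_pi_apply (Y := fun i : α.1 => X i) i fun y => I.φV i y j]

end LocalFamily

/-! ### Gaussian families -/

section PairProd

@[simp]
theorem pairProd_mk {κ : Type*} (y : κ → ℝ) (i j : κ) : pairProd y s(i, j) = y i * y j := rfl

variable {κ : Type*} [Fintype κ] [DecidableEq κ]

/-- Expresses the rank-one part of the Gaussian exponent through the sufficient statistics; each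
unordered pair stems from two ordered ones. -/
theorem sq_sum_eq_sum_pairProd (y : κ → ℝ) :
    (∑ i, y i) ^ 2 = ∑ i, y i ^ 2 + 2 * ∑ s : {s : Sym2 κ // ¬ s.IsDiag}, pairProd y s.1 := by
  have h1 : (∑ i, y i) ^ 2 = ∑ p : κ × κ, y p.1 * y p.2 := by
    rw [sq, Finset.sum_mul_sum, Fintype.sum_prod_type]
  have h2 : ∑ p ∈ Finset.univ.filter (fun p : κ × κ => p.1 = p.2), y p.1 * y p.2 =
      ∑ i, y i ^ 2 := by
    rw [Finset.sum_filter, Fintype.sum_prod_type]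
    simp [sq]
  have h3 : ∑ p ∈ Finset.univ.filter (fun p : κ × κ => ¬ p.1 = p.2), y p.1 * y p.2 =
      2 * ∑ s : {s : Sym2 κ // ¬ s.IsDiag}, pairProd y s.1 := by
    rw [← Finset.sum_subtype (Finset.univ.filter fun s : Sym2 κ => ¬ s.IsDiag) (by simp)
      (pairProd y), Finset.mul_sum,
      ← Finset.sum_fiberwise_of_maps_to (g := fun p : κ × κ => s(p.1, p.2))
        (t := Finset.univ.filter fun s : Sym2 κ => ¬ s.IsDiag) (by simp)]
    refine Finset.sum_congr rfl fun s hs => ?_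
    induction s using Sym2.ind with
    | _ a b =>
      have hab : a ≠ b := by simpa using hs
      have : (Finset.univ.filter (fun p : κ × κ => ¬ p.1 = p.2)).filter
          (fun p => s(p.1, p.2) = s(a, b)) = {(a, b), (b, a)} := by
        ext ⟨c, d⟩
        simp only [Finset.mem_filter, Finset.mem_univ, true_and, Sym2.eq_iff, Finset.mem_insert,
          Finset.mem_singleton, Prod.mk.injEq]
        constructor
        · exact fun h => h.2
        · rintro (⟨rfl, rfl⟩ | ⟨rfl, rfl⟩)
          · exact ⟨hab, by simp⟩
          · exact ⟨hab.symm, by simp⟩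
      rw [this, Finset.sum_pair (by simp [hab])]
      simp
      ring
  rw [h1, ← Finset.sum_filter_add_sum_filter_not _ (fun p : κ × κ => p.1 = p.2), h2, h3]

theorem abs_pairProd_le (y : κ → ℝ) {s : Sym2 κ} (hs : ¬ s.IsDiag) :
    |pairProd y s| ≤ ∑ i, y i ^ 2 := by
  induction s using Sym2.ind with
  | _ a b =>
    have hab : a ≠ b := by simpa using hs
    have h := Finset.sum_le_sum_of_subset_of_nonneg (f := fun i => y i ^ 2)
      (Finset.subset_univ {a, b}) fun i _ _ => sq_nonneg _
    rw [Finset.sum_pair hab] at h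
    rw [pairProd_mk, abs_le]
    constructor <;> nlinarith [sq_nonneg (y a + y b), sq_nonneg (y a - y b)]

end PairProd

/-- A criterion for natural parameters: the statistic is bounded by `1 + Q` and the exponent is
at most a negative multiple of `Q`, up to a constant. -/
theorem ExpFamily.mem_natDomain_of_le {Ω ι : Type*} [MeasurableSpace Ω] [Fintype ι]
    {ν : Measure Ω} {φ : Ω → ι → ℝ} (hφ : ∀ j, Measurable fun x => φ x j) {Q : Ω → ℝ}
    (hQ0 : ∀ x, 0 ≤ Q x) (hQ : ∀ c > 0, Integrable (fun x => Real.exp (-c * Q x)) ν)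
    (hφQ : ∀ j x, |φ x j| ≤ 1 + Q x) {θ : ι → ℝ} {c : ℝ} (hc : 0 < c)
    (hθ : ∀ x, ∑ j, θ j * φ x j ≤ -c * Q x) : θ ∈ natDomain ν φ := by
  set N : ℝ := (Fintype.card ι : ℝ) with hN
  have hN0 : 0 ≤ N := Nat.cast_nonneg _
  -- Moving each parameter by at most r raises the exponent by at most N r (1 + Q), and N r ≤ c / 2
  -- leaves half of the decay.
  set r : ℝ := c / (2 * (N + 1)) with hr
  have hr0 : 0 < r := by positivity
  have hrN : N * r ≤ c / 2 := by
    rw [hr, mul_div_assoc', div_le_div_iff₀ (by positivity) two_pos]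
    nlinarith
  rw [natDomain, mem_interior]
  refine ⟨Metric.ball θ r, fun θ' hθ' => ?_, Metric.isOpen_ball, Metric.mem_ball_self hr0⟩
  have hd : ∀ j, |θ' j - θ j| ≤ r := fun j => by
    rw [← Real.dist_eq]
    exact (dist_le_pi_dist θ' θ j).trans (Metric.mem_ball.1 hθ').le
  refine ((hQ (c / 2) (by positivity)).mul_const (Real.exp (N * r))).mono'
    (Measurable.aestronglyMeasurable (by fun_prop)) (Eventually.of_forall fun x => ?_)
  rw [Real.norm_eq_abs, abs_of_pos (Real.exp_pos _), ← Real.exp_add, Real.exp_le_exp]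
  have h1 : ∑ j, (θ' j - θ j) * φ x j ≤ ∑ _j : ι, r * (1 + Q x) := by
    refine Finset.sum_le_sum fun j _ => (le_abs_self _).trans ?_
    rw [abs_mul]
    exact mul_le_mul (hd j) (hφQ j x) (abs_nonneg _) hr0.le
  rw [Finset.sum_const, Finset.card_univ, nsmul_eq_mul, ← hN] at h1
  simp_rw [sub_mul, Finset.sum_sub_distrib] at h1
  have h2 := hθ x
  have h3 := mul_le_mul_of_nonneg_right hrN (hQ0 x)
  linarith

/-- The parameter and the value of the Legendre transform, from the normalization
and the moments of the unnormalized density `exp (-q)`. -/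
theorem ExpFamily.mean_legendre_of_exponent {Ω ι : Type*} [MeasurableSpace Ω] [Fintype ι]
    {ν : Measure Ω} {φ : Ω → ι → ℝ} (hφ : ∀ j, Measurable fun x => φ x j) {θ : ι → ℝ}
    (hθ : θ ∈ natDomain ν φ) {q : Ω → ℝ} (hq : ∀ x, ∑ j, θ j * φ x j = -q x) {Z e : ℝ} (hZ : 0 < Z)
    (h0 : ∫ x, Real.exp (-q x) ∂ν = Z) (hqq : ∫ x, q x * Real.exp (-q x) ∂ν = Z * e) {η : ι → ℝ}
    (hη : ∀ j, ∫ x, φ x j * Real.exp (-q x) ∂ν = Z * η j) :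
    η ∈ meanDomain ν φ ∧ legendre ν φ η = -e - Real.log Z := by
  have hν : ν ≠ 0 := by
    rintro rfl
    simp at h0
    linarith
  have hψ : logPartition ν φ θ = Real.log Z := by
    simp_rw [logPartition, hq, h0]
  have hdens : ∀ x, density ν φ θ x = Real.exp (-q x) / Z := fun x => by
    rw [density, hq, hψ, Real.exp_sub, Real.exp_log hZ]
  have hint : ∀ f : Ω → ℝ, ∀ a, ∫ x, f x * Real.exp (-q x) ∂ν = Z * a →
      ∫ x, f x ∂(law ν φ θ) = a := fun f a ha => by
    rw [integral_law hφ]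
    have : ∀ x, density ν φ θ x * f x = f x * Real.exp (-q x) / Z := fun x => by
      rw [hdens]
      ring
    simp_rw [this]
    rw [integral_div, ha, mul_div_cancel_left₀ _ hZ.ne']
  have hmean : meanParam ν φ θ = η := funext fun j => hint _ _ (hη j)
  refine ⟨⟨θ, hθ, hmean⟩, ?_⟩
  have hlin := integral_linear_stat hφ hθ θ
  simp_rw [hq] at hlin
  rw [integral_neg, hint q e hqq] at hlin
  rw [← hmean, legendre_meanParam hν hφ hθ, ← hlin, hψ]

/-! ### Moments of the standard Gaussian -/

section Std

theorem integral_gaussianPDFReal_zero_one : ∫ x, gaussianPDFReal 0 1 x = 1 :=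
  integral_gaussianPDFReal_eq_one 0 one_ne_zero

theorem integral_mul_gaussianPDFReal {v : NNReal} (hv : v ≠ 0) (m : ℝ) :
    ∫ x, x * gaussianPDFReal m v x = m := by
  have h := integral_gaussianReal_eq_integral_smul (μ := m) (f := fun x : ℝ => x) hv
  rw [integral_id_gaussianReal] at h
  simpa only [smul_eq_mul, mul_comm] using h.symm

theorem integral_sq_sub_mul_gaussianPDFReal {v : NNReal} (hv : v ≠ 0) (m : ℝ) :
    ∫ x, (x - m) ^ 2 * gaussianPDFReal m v x = v := by
  have h := integral_gaussianReal_eq_integral_smul (μ := m) (f := fun x : ℝ => (x - m) ^ 2) hv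
  have h2 := variance_id_gaussianReal (μ := m) (v := v)
  rw [variance_eq_integral (by fun_prop)] at h2
  simp only [id_eq, integral_id_gaussianReal] at h2
  rw [h2] at h
  rw [h]
  simp_rw [smul_eq_mul, mul_comm]

theorem integrable_pow_mul_gaussianPDFReal (n : ℕ) :
    Integrable fun x => x ^ n * gaussianPDFReal 0 1 x := by
  have h := (integrable_rpow_mul_exp_neg_mul_sq (b := 2⁻¹) (by norm_num)
    (s := n) (by linarith [n.cast_nonneg (α := ℝ)])).const_mul (√(2 * Real.pi))⁻¹
  refine h.congr (Eventually.of_forall fun x => ?_)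
  simp only [gaussianPDFReal_def, Real.rpow_natCast, NNReal.coe_one, mul_one, sub_zero]
  rw [show -x ^ 2 / 2 = -2⁻¹ * x ^ 2 by ring]
  ring

variable {κ : Type*} [Fintype κ]

/-- The density of the standard Gaussian distribution on `ℝ^κ`. -/
def stdDensity (z : κ → ℝ) : ℝ := ∏ i, gaussianPDFReal 0 1 (z i)

theorem stdDensity_eq (z : κ → ℝ) :
    stdDensity z = (√(2 * Real.pi) ^ Fintype.card κ)⁻¹ * Real.exp (-(2⁻¹ * ∑ i, z i ^ 2)) := by
  simp_rw [stdDensity, gaussianPDFReal_def]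
  rw [Finset.prod_mul_distrib, ← Real.exp_sum, Finset.prod_const, Finset.card_univ, inv_pow]
  congr 2
  · simp
  · rw [Finset.mul_sum, ← Finset.sum_neg_distrib]
    refine Finset.sum_congr rfl fun i _ => ?_
    simp
    ring

theorem integral_stdDensity : ∫ z : κ → ℝ, stdDensity z = 1 := by
  simp_rw [stdDensity]
  rw [integral_fintype_prod_volume_eq_prod fun (_ : κ) x => gaussianPDFReal 0 1 x]
  simp [integral_gaussianPDFReal_zero_one]

variable [DecidableEq κ]

/-- The monomial is spread over all coordinates as powers with exponent 0 or 1, so that integrals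
factor by Fubini. -/
theorem coord_mul_stdDensity (a : κ) (z : κ → ℝ) :
    z a * stdDensity z = ∏ i, (z i) ^ (if i = a then 1 else 0) * gaussianPDFReal 0 1 (z i) := by
  rw [Finset.prod_mul_distrib, stdDensity]
  simp

theorem coord_mul_coord_mul_stdDensity (a b : κ) (z : κ → ℝ) :
    z a * z b * stdDensity z =
      ∏ i, (z i) ^ ((if i = a then 1 else 0) + (if i = b then 1 else 0)) *
        gaussianPDFReal 0 1 (z i) := by
  simp_rw [pow_add]
  rw [Finset.prod_mul_distrib, Finset.prod_mul_distrib, stdDensity]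
  simp

theorem integrable_coord_mul_stdDensity (a : κ) :
    Integrable fun z : κ → ℝ => z a * stdDensity z := by
  simp_rw [coord_mul_stdDensity]
  exact Integrable.fintype_prod (f := fun i x => x ^ (if i = a then 1 else 0) *
    gaussianPDFReal 0 1 x) fun i => integrable_pow_mul_gaussianPDFReal _

theorem integrable_coord_mul_coord_mul_stdDensity (a b : κ) :
    Integrable fun z : κ → ℝ => z a * z b * stdDensity z := by
  simp_rw [coord_mul_coord_mul_stdDensity]
  exact Integrable.fintype_prod (f := fun i x => x ^ ((if i = a then 1 else 0) +
    (if i = b then 1 else 0)) * gaussianPDFReal 0 1 x) fun i => integrable_pow_mul_gaussianPDFReal _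

theorem integral_coord_mul_stdDensity (a : κ) : ∫ z : κ → ℝ, z a * stdDensity z = 0 := by
  simp_rw [coord_mul_stdDensity]
  rw [integral_fintype_prod_volume_eq_prod fun (i : κ) x => x ^ (if i = a then 1 else 0) *
    gaussianPDFReal 0 1 x]
  refine Finset.prod_eq_zero (Finset.mem_univ a) ?_
  simpa using integral_mul_gaussianPDFReal one_ne_zero 0

theorem integral_coord_mul_coord_mul_stdDensity (a b : κ) :
    ∫ z : κ → ℝ, z a * z b * stdDensity z = if a = b then 1 else 0 := by
  simp_rw [coord_mul_coord_mul_stdDensity]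
  rw [integral_fintype_prod_volume_eq_prod fun (i : κ) x => x ^ ((if i = a then 1 else 0) +
    (if i = b then 1 else 0)) * gaussianPDFReal 0 1 x]
  split_ifs with h
  · subst h
    refine Finset.prod_eq_one fun i _ => ?_
    by_cases hi : i = a
    · simpa [hi] using integral_sq_sub_mul_gaussianPDFReal one_ne_zero 0
    · simpa [hi] using integral_gaussianPDFReal_zero_one
  · refine Finset.prod_eq_zero (Finset.mem_univ a) ?_
    simpa [h] using integral_mul_gaussianPDFReal one_ne_zero 0

theorem integral_linear_mul_linear_mul_stdDensity (u v : κ → ℝ) :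
    ∫ z : κ → ℝ, (∑ a, u a * z a) * (∑ b, v b * z b) * stdDensity z = ∑ a, u a * v a := by
  have : ∀ z : κ → ℝ, (∑ a, u a * z a) * (∑ b, v b * z b) * stdDensity z =
      ∑ a, ∑ b, u a * v b * (z a * z b * stdDensity z) := fun z => by
    rw [Finset.sum_mul_sum, Finset.sum_mul]
    refine Finset.sum_congr rfl fun a _ => ?_
    rw [Finset.sum_mul]
    exact Finset.sum_congr rfl fun b _ => by ring
  simp_rw [this]
  have hi := fun a b => (integrable_coord_mul_coord_mul_stdDensity a b).const_mul (u a * v b)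
  rw [integral_finsetSum _ fun a _ => integrable_finsetSum _ fun b _ => hi a b]
  refine Finset.sum_congr rfl fun a _ => ?_
  rw [integral_finsetSum _ fun b _ => hi a b]
  simp_rw [integral_const_mul, integral_coord_mul_coord_mul_stdDensity]
  simp

theorem integral_linear_mul_stdDensity (u : κ → ℝ) :
    ∫ z : κ → ℝ, (∑ a, u a * z a) * stdDensity z = 0 := by
  simp_rw [Finset.sum_mul, mul_assoc]
  rw [integral_finsetSum _ fun a _ => (integrable_coord_mul_stdDensity a).const_mul (u a)]
  simp_rw [integral_const_mul, integral_coord_mul_stdDensity]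
  simp

end Std

/-! ### Equicorrelated Gaussians -/

section Equicorrelated

variable {κ : Type*} [Fintype κ]

/-- The exponent of the centred Gaussian density on `ℝ^κ` with covariance matrix `a² I + t J`,
where `J` is the all-ones matrix and `t |κ| = b² - a²`. -/
def equiQuad (a b : ℝ) (y : κ → ℝ) : ℝ :=
  (2 * a ^ 2)⁻¹ * (∑ i, y i ^ 2 - (b ^ 2 - a ^ 2) / (Fintype.card κ * b ^ 2) * (∑ i, y i) ^ 2)

theorem continuous_equiQuad {a b : ℝ} : Continuous (equiQuad a b : (κ → ℝ) → ℝ) := by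
  unfold equiQuad
  fun_prop

/-- By Cauchy–Schwarz: b² is the largest eigenvalue of the covariance, attained on constant vectors.
-/
theorem le_equiQuad [Nonempty κ] {a b : ℝ} (ha : 0 < a) (hab : a ≤ b) (y : κ → ℝ) :
    (2 * b ^ 2)⁻¹ * ∑ i, y i ^ 2 ≤ equiQuad a b y := by
  have hk : (0 : ℝ) < Fintype.card κ := by exact_mod_cast Fintype.card_pos
  have hb : 0 < b := ha.trans_le hab
  have h1 : (∑ i, y i) ^ 2 ≤ Fintype.card κ * ∑ i, y i ^ 2 := sq_sum_le_card_mul_sum_sq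
  have h2 : 0 ≤ (b ^ 2 - a ^ 2) / (Fintype.card κ * b ^ 2) :=
    div_nonneg (by nlinarith) (by positivity)
  have h3 := mul_le_mul_of_nonneg_left h1 h2
  have h4 : (2 * b ^ 2)⁻¹ * ∑ i, y i ^ 2 = (2 * a ^ 2)⁻¹ * (∑ i, y i ^ 2 -
      (b ^ 2 - a ^ 2) / (Fintype.card κ * b ^ 2) * (Fintype.card κ * ∑ i, y i ^ 2)) := by
    field_simp
    ring
  rw [h4, equiQuad]
  gcongr

/-- The normalizing constant of `exp (-equiQuad a b)`. -/
def equiNorm (κ : Type*) [Fintype κ] (a b : ℝ) : ℝ :=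
  a ^ Fintype.card κ * (b / a) * √(2 * Real.pi) ^ Fintype.card κ

theorem equiNorm_pos {a b : ℝ} (ha : 0 < a) (hb : 0 < b) : 0 < equiNorm κ a b := by
  unfold equiNorm
  positivity

theorem log_equiNorm {a b : ℝ} (ha : 0 < a) (hb : 0 < b) :
    Real.log (equiNorm κ a b) = Real.log b +
      (Fintype.card κ * Real.log a - Real.log a + Fintype.card κ * Real.log √(2 * Real.pi)) := by
  have h : √(2 * Real.pi) ^ Fintype.card κ ≠ 0 := by positivity
  rw [equiNorm, Real.log_mul (by positivity) h, Real.log_mul (by positivity) (by positivity),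
    Real.log_div hb.ne' ha.ne', Real.log_pow, Real.log_pow]
  ring

variable [DecidableEq κ]

/-- The symmetric square root of `a² I + t J`, where `t |κ| = b² - a²`. -/
def equiRoot (κ : Type*) [Fintype κ] [DecidableEq κ] (a b : ℝ) : Matrix κ κ ℝ :=
  Matrix.of fun i j => a * (if i = j then 1 else 0) + (b - a) / Fintype.card κ

theorem equiRoot_mulVec (a b : ℝ) (z : κ → ℝ) (i : κ) :
    (equiRoot κ a b).mulVec z i = a * z i + (b - a) / Fintype.card κ * ∑ j, z j := by
  simp [equiRoot, Matrix.mulVec, dotProduct, add_mul, Finset.sum_add_distrib, Finset.mul_sum]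

variable [Nonempty κ]

/-- Matrix determinant lemma for a times a rank-one perturbation of the identity. -/
theorem det_equiRoot {a : ℝ} (ha : a ≠ 0) (b : ℝ) :
    (equiRoot κ a b).det = a ^ Fintype.card κ * (b / a) := by
  have hk : (Fintype.card κ : ℝ) ≠ 0 := by exact_mod_cast Fintype.card_ne_zero
  have h : equiRoot κ a b = a • (1 + Matrix.replicateCol Unit
      (fun _ : κ => (b - a) / (a * Fintype.card κ)) *
        Matrix.replicateRow Unit fun _ : κ => (1 : ℝ)) := by
    ext i j
    simp only [equiRoot, Matrix.of_apply, Matrix.smul_apply, Matrix.add_apply, Matrix.one_apply,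
      Matrix.mul_apply, Matrix.replicateCol_apply, Matrix.replicateRow_apply, smul_eq_mul,
      Finset.univ_unique, Finset.sum_singleton]
    field_simp
  rw [h, Matrix.det_smul, Matrix.det_one_add_replicateCol_mul_replicateRow]
  simp only [dotProduct, one_mul, Finset.sum_const, Finset.card_univ, nsmul_eq_mul]
  congr 1
  field_simp
  ring

/-- The root scales constant vectors by b and their orthogonal complement by a, which normalizes the
form of the inverse covariance. -/
theorem equiQuad_equiRoot_mulVec {a b : ℝ} (ha : a ≠ 0) (hb : b ≠ 0) (z : κ → ℝ) :
    equiQuad a b ((equiRoot κ a b).mulVec z) = 2⁻¹ * ∑ i, z i ^ 2 := by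
  have hk : (Fintype.card κ : ℝ) ≠ 0 := by exact_mod_cast Fintype.card_ne_zero
  simp_rw [equiQuad, equiRoot_mulVec]
  set S := ∑ j, z j with hS
  have h1 : ∑ i, (a * z i + (b - a) / Fintype.card κ * S) = b * S := by
    rw [Finset.sum_add_distrib, ← Finset.mul_sum, ← hS, Finset.sum_const, Finset.card_univ,
      nsmul_eq_mul]
    field_simp
    ring
  have h2 : ∑ i, (a * z i + (b - a) / Fintype.card κ * S) ^ 2 =
      a ^ 2 * ∑ i, z i ^ 2 + (b ^ 2 - a ^ 2) / Fintype.card κ * S ^ 2 := by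
    have : ∀ i, (a * z i + (b - a) / Fintype.card κ * S) ^ 2 = a ^ 2 * z i ^ 2 +
        2 * a * ((b - a) / Fintype.card κ) * S * z i + ((b - a) / Fintype.card κ * S) ^ 2 :=
      fun i => by ring
    simp_rw [this, Finset.sum_add_distrib, ← Finset.mul_sum, ← hS]
    rw [Finset.sum_const, Finset.card_univ, nsmul_eq_mul]
    field_simp
    ring
  rw [h1, h2]
  field_simp
  ring

/-- Substitution of x = m + R z with R the root; `equiNorm` collects det R and the standard
normalization. -/
theorem integral_mul_exp_neg_equiQuad {a b : ℝ} (ha : 0 < a) (hb : 0 < b) (m : κ → ℝ)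
    {f : (κ → ℝ) → ℝ} (hf : Continuous f) :
    ∫ x, f (x - m) * Real.exp (-equiQuad a b (x - m)) =
      equiNorm κ a b * ∫ z, f ((equiRoot κ a b).mulVec z) * stdDensity z := by
  rw [integral_sub_right_eq_self fun y => f y * Real.exp (-equiQuad a b y)]
  have hdet : (equiRoot κ a b).det = a ^ Fintype.card κ * (b / a) := det_equiRoot ha.ne' b
  have hdpos : 0 < (equiRoot κ a b).det := by
    rw [hdet]
    positivity
  have hcont : Continuous fun y : κ → ℝ => f y * Real.exp (-equiQuad a b y) :=
    hf.mul (Real.continuous_exp.comp continuous_equiQuad.neg)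
  have hmap := Real.map_matrix_volume_pi_eq_smul_volume_pi hdpos.ne'
  have hlin : Continuous (Matrix.toLin' (equiRoot κ a b)) :=
    LinearMap.continuous_of_finiteDimensional _
  have h1 : ∫ y, f y * Real.exp (-equiQuad a b y) ∂(Measure.map (Matrix.toLin' (equiRoot κ a b))
      volume) = ∫ z, f ((equiRoot κ a b).mulVec z) *
        Real.exp (-(2⁻¹ * ∑ i, z i ^ 2)) := by
    rw [integral_map hlin.aemeasurable hcont.aestronglyMeasurable]
    simp_rw [Matrix.toLin'_apply, equiQuad_equiRoot_mulVec ha.ne' hb.ne']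
  rw [hmap, integral_smul_measure, ENNReal.toReal_ofReal (abs_nonneg _),
    abs_of_pos (inv_pos.2 hdpos), smul_eq_mul, inv_mul_eq_iff_eq_mul₀ hdpos.ne'] at h1
  rw [h1]
  simp_rw [stdDensity_eq]
  have : ∀ z : κ → ℝ, f ((equiRoot κ a b).mulVec z) *
      ((√(2 * Real.pi) ^ Fintype.card κ)⁻¹ * Real.exp (-(2⁻¹ * ∑ i, z i ^ 2))) =
      (√(2 * Real.pi) ^ Fintype.card κ)⁻¹ * (f ((equiRoot κ a b).mulVec z) *
        Real.exp (-(2⁻¹ * ∑ i, z i ^ 2))) := fun z => by ring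
  simp_rw [this]
  rw [integral_const_mul, equiNorm, hdet]
  have : √(2 * Real.pi) ^ Fintype.card κ ≠ 0 := by positivity
  field_simp

theorem integral_exp_neg_equiQuad {a b : ℝ} (ha : 0 < a) (hb : 0 < b) (m : κ → ℝ) :
    ∫ x, Real.exp (-equiQuad a b (x - m)) = equiNorm κ a b := by
  have h := integral_mul_exp_neg_equiQuad ha hb m (f := fun _ => 1) continuous_const
  simpa [integral_stdDensity] using h

theorem integral_equiQuad_mul_exp_neg {a b : ℝ} (ha : 0 < a) (hb : 0 < b) (m : κ → ℝ) :
    ∫ x, equiQuad a b (x - m) * Real.exp (-equiQuad a b (x - m)) =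
      equiNorm κ a b * (Fintype.card κ / 2) := by
  rw [integral_mul_exp_neg_equiQuad ha hb m continuous_equiQuad]
  congr 1
  simp_rw [equiQuad_equiRoot_mulVec ha.ne' hb.ne', Finset.mul_sum, Finset.sum_mul, sq, mul_assoc]
  have hi : ∀ i : κ, Integrable fun z : κ → ℝ => 2⁻¹ * (z i * (z i * stdDensity z)) := fun i => by
    simpa only [mul_assoc] using (integrable_coord_mul_coord_mul_stdDensity i i).const_mul 2⁻¹
  rw [integral_finsetSum _ fun i _ => hi i]
  simp_rw [integral_const_mul, ← mul_assoc, integral_coord_mul_coord_mul_stdDensity]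
  simp
  ring

theorem integral_coord_mul_exp_neg_equiQuad {a b : ℝ} (ha : 0 < a) (hb : 0 < b) (m : κ → ℝ)
    (i : κ) : ∫ x, (x i - m i) * Real.exp (-equiQuad a b (x - m)) = 0 := by
  have h := integral_mul_exp_neg_equiQuad ha hb m (f := fun y => y i) (continuous_apply i)
  simp only [Pi.sub_apply] at h
  rw [h]
  simp only [Matrix.mulVec, dotProduct]
  rw [integral_linear_mul_stdDensity, mul_zero]

theorem integral_coord_mul_coord_mul_exp_neg_equiQuad {a b : ℝ} (ha : 0 < a) (hb : 0 < b)
    (m : κ → ℝ) (i j : κ) :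
    ∫ x, (x i - m i) * (x j - m j) * Real.exp (-equiQuad a b (x - m)) =
      equiNorm κ a b * ((b ^ 2 - a ^ 2) / Fintype.card κ + if i = j then a ^ 2 else 0) := by
  have hk : (Fintype.card κ : ℝ) ≠ 0 := by exact_mod_cast Fintype.card_ne_zero
  have h := integral_mul_exp_neg_equiQuad ha hb m (f := fun y => y i * y j) (by fun_prop)
  simp only [Pi.sub_apply] at h
  rw [h]
  simp only [Matrix.mulVec, dotProduct]
  rw [integral_linear_mul_linear_mul_stdDensity]
  congr 1
  have hsum : ∀ l, equiRoot κ a b i l * equiRoot κ a b j l =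
      (if i = l then a ^ 2 * (if j = l then 1 else 0) else 0) +
      (if i = l then a * ((b - a) / Fintype.card κ) else 0) +
      (if j = l then a * ((b - a) / Fintype.card κ) else 0) + ((b - a) / Fintype.card κ) ^ 2 := by
    intro l
    simp only [equiRoot, Matrix.of_apply]
    split_ifs <;> ring
  simp_rw [hsum, Finset.sum_add_distrib]
  rw [Finset.sum_const, Finset.card_univ, nsmul_eq_mul]
  simp only [Finset.sum_ite_eq, Finset.mem_univ, if_true]
  by_cases hij : i = j
  · simp only [hij, if_true]
    field_simp
    ring
  · simp only [hij, Ne.symm hij, if_false]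
    field_simp
    ring

end Equicorrelated

theorem integrable_exp_neg_mul_sum_sq {κ : Type*} [Fintype κ] (m : κ → ℝ) {c : ℝ} (hc : 0 < c) :
    Integrable fun x : κ → ℝ => Real.exp (-c * ∑ i, (x i - m i) ^ 2) := by
  simp_rw [Finset.mul_sum, Real.exp_sum]
  exact Integrable.fintype_prod (f := fun i x => Real.exp (-c * (x - m i) ^ 2)) fun i =>
    (integrable_exp_neg_mul_sq hc).comp_sub_right (m i)

/-- The part of the negative entropy of an equicorrelated Gaussian that depends only on `ε`. -/
def equiConst (κ : Type*) [Fintype κ] (ε : ℝ) : ℝ :=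
  -(Fintype.card κ / 2 : ℝ) - (Fintype.card κ * Real.log √ε - Real.log √ε +
    Fintype.card κ * Real.log √(2 * Real.pi))

/-- The Legendre transform at the moments of the Gaussian distribution with covariance matrix
`ε I + t J`, for families whose exponents contain that of this distribution. -/
theorem equicorrelated_mem_and_legendre {κ ι : Type*} [Fintype κ] [DecidableEq κ] [Nonempty κ]
    [Fintype ι] {φ : (κ → ℝ) → ι → ℝ} (hφ : ∀ j, Measurable fun x => φ x j) (m : κ → ℝ)
    (hφQ : ∀ j x, |φ x j| ≤ 1 + ∑ i, (x i - m i) ^ 2) {ε t : ℝ} (hε : 0 < ε) (ht : 0 ≤ t)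
    {θ : ι → ℝ} (hθ : ∀ x, ∑ j, θ j * φ x j =
      -equiQuad √ε √(ε + Fintype.card κ * t) (x - m)) {η : ι → ℝ}
    (hη : ∀ j, ∫ x, φ x j * Real.exp (-equiQuad √ε √(ε + Fintype.card κ * t) (x - m)) =
      equiNorm κ √ε √(ε + Fintype.card κ * t) * η j) :
    η ∈ ExpFamily.meanDomain volume φ ∧ ExpFamily.legendre volume φ η =
      -(1 / 2) * Real.log (ε + Fintype.card κ * t) + equiConst κ ε := by
  have hkt : 0 ≤ Fintype.card κ * t := by positivity
  have ha : 0 < √ε := Real.sqrt_pos.2 hε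
  have hb : 0 < √(ε + Fintype.card κ * t) := Real.sqrt_pos.2 (by linarith)
  have hab : √ε ≤ √(ε + Fintype.card κ * t) := Real.sqrt_le_sqrt (by linarith)
  have hmem : θ ∈ ExpFamily.natDomain volume φ := by
    refine ExpFamily.mem_natDomain_of_le hφ (Q := fun x => ∑ i, (x i - m i) ^ 2)
      (fun x => Finset.sum_nonneg fun i _ => sq_nonneg _)
      (fun c hc => integrable_exp_neg_mul_sum_sq m hc) hφQ
      (c := (2 * √(ε + Fintype.card κ * t) ^ 2)⁻¹) (by positivity) fun x => ?_
    have := le_equiQuad ha hab (x - m)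
    simp only [Pi.sub_apply] at this
    rw [hθ]
    linarith
  have := ExpFamily.mean_legendre_of_exponent hφ hmem hθ (equiNorm_pos ha hb)
    (integral_exp_neg_equiQuad ha hb m) (integral_equiQuad_mul_exp_neg ha hb m) hη
  refine ⟨this.1, ?_⟩
  rw [this.2, log_equiNorm ha hb, equiConst, Real.log_sqrt (by linarith : (0:ℝ) ≤ ε + _)]
  ring

/-- The one-dimensional case, with mean `m` and variance `v`. -/
theorem gaussianReal_mem_and_legendre {ι : Type*} [Fintype ι] {φ : ℝ → ι → ℝ}
    (hφ : ∀ j, Measurable fun x => φ x j) (m : ℝ) (hφQ : ∀ j x, |φ x j| ≤ 1 + (x - m) ^ 2) {v : ℝ}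
    (hv : 0 < v) {θ : ι → ℝ} (hθ : ∀ x, ∑ j, θ j * φ x j = -((2 * v)⁻¹ * (x - m) ^ 2)) {η : ι → ℝ}
    (hη : ∀ j, ∫ x, φ x j * gaussianPDFReal m v.toNNReal x = η j) :
    η ∈ ExpFamily.meanDomain volume φ ∧ ExpFamily.legendre volume φ η =
      -(1 / 2) * Real.log v - (1 / 2 + Real.log √(2 * Real.pi)) := by
  have hv' : v.toNNReal ≠ 0 := by simpa using hv
  have hcoe : (v.toNNReal : ℝ) = v := Real.coe_toNNReal v hv.le
  have hmem : θ ∈ ExpFamily.natDomain volume φ :=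
    ExpFamily.mem_natDomain_of_le hφ (Q := fun x => (x - m) ^ 2) (fun x => sq_nonneg _)
      (fun c hc => (integrable_exp_neg_mul_sq hc).comp_sub_right m) hφQ
      (c := (2 * v)⁻¹) (by positivity) fun x => by rw [hθ]; linarith
  have hZ : 0 < √(2 * Real.pi * v) := by positivity
  have hpdf : ∀ x, Real.exp (-((2 * v)⁻¹ * (x - m) ^ 2)) =
      √(2 * Real.pi * v) * gaussianPDFReal m v.toNNReal x := fun x => by
    rw [gaussianPDFReal_def, hcoe]
    simp only
    rw [mul_inv_cancel_left₀ hZ.ne']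
    congr 1
    field_simp
  have hint : ∀ f : ℝ → ℝ, ∫ x, f x * Real.exp (-((2 * v)⁻¹ * (x - m) ^ 2)) =
      √(2 * Real.pi * v) * ∫ x, f x * gaussianPDFReal m v.toNNReal x := fun f => by
    rw [← integral_const_mul]
    exact integral_congr_ae (Eventually.of_forall fun x => by simp only [hpdf]; ring)
  have h0 : ∫ x, Real.exp (-((2 * v)⁻¹ * (x - m) ^ 2)) = √(2 * Real.pi * v) := by
    simpa [integral_gaussianPDFReal_eq_one m hv'] using hint fun _ => 1
  have hqq : ∫ x, (2 * v)⁻¹ * (x - m) ^ 2 * Real.exp (-((2 * v)⁻¹ * (x - m) ^ 2)) =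
      √(2 * Real.pi * v) * (1 / 2) := by
    rw [hint]
    simp_rw [mul_assoc]
    rw [integral_const_mul, integral_sq_sub_mul_gaussianPDFReal hv', hcoe]
    field_simp
  have := ExpFamily.mean_legendre_of_exponent hφ hmem hθ hZ h0 hqq
    fun j => by rw [hint, hη]
  refine ⟨this.1, ?_⟩
  rw [this.2, Real.sqrt_mul (by positivity), Real.log_mul (by positivity) (by positivity),
    Real.log_sqrt hv.le]
  ring

theorem log_three_sub_log_two_neg : Real.log 3 / 4 - Real.log 2 / 2 < 0 := by
  have h : Real.log 3 < Real.log (2 ^ 2) := Real.log_lt_log (by norm_num) (by norm_num)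
  rw [Real.log_pow] at h
  push_cast at h
  linarith

/-- D cancels for every ε and log k in the limit, so the limit is the same for all k: it is the
midpoint difference of -½ log t on [1, 3]. -/
theorem tendsto_second_difference_log {k : ℝ} (hk : 0 < k) (D : ℝ → ℝ) :
    Tendsto (fun ε => (-(1 / 2) * Real.log (ε + k * ((1 + 3) / 2)) + D ε) -
      ((-(1 / 2) * Real.log (ε + k * 1) + D ε) + (-(1 / 2) * Real.log (ε + k * 3) + D ε)) / 2)
      (𝓝[>] 0) (𝓝 (Real.log 3 / 4 - Real.log 2 / 2)) := by
  have hl : ∀ r : ℝ, 0 < r → Tendsto (fun ε => Real.log (ε + k * r)) (𝓝[>] 0)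
      (𝓝 (Real.log k + Real.log r)) := fun r hr => by
    have hc : ContinuousAt (fun ε => Real.log (ε + k * r)) 0 := by
      refine ContinuousAt.log (by fun_prop) ?_
      rw [zero_add]
      positivity
    have := hc.tendsto.mono_left (nhdsWithin_le_nhds (s := Set.Ioi 0))
    rwa [zero_add, Real.log_mul hk.ne' hr.ne'] at this
  have := ((hl ((1 + 3) / 2) (by norm_num)).const_mul (-(1 / 2))).sub
    ((((hl 1 one_pos).const_mul (-(1 / 2))).add
      ((hl 3 (by norm_num)).const_mul (-(1 / 2)))).div_const 2)
  convert this using 2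
  · ring
  · rw [Real.log_one, show ((1 : ℝ) + 3) / 2 = 2 by norm_num]
    ring

/-! ### Moments and entropies in terms of the Gaussian statistics -/

section PairMoments

theorem measurable_pairProd {κ Ω : Type*} [MeasurableSpace Ω] {y : Ω → κ → ℝ}
    (hy : ∀ i, Measurable fun x => y x i) (s : Sym2 κ) : Measurable fun x => pairProd (y x) s := by
  induction s using Sym2.ind with
  | _ i j => exact (hy i).mul (hy j)

theorem sq_le_one_add_sum_sq {κ : Type*} [Fintype κ] (y : κ → ℝ) (i : κ) :
    |y i ^ 2| ≤ 1 + ∑ i, y i ^ 2 := by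
  rw [abs_of_nonneg (sq_nonneg _)]
  have : y i ^ 2 ≤ ∑ i, y i ^ 2 :=
    Finset.single_le_sum (f := fun i => y i ^ 2) (fun i _ => sq_nonneg _) (Finset.mem_univ i)
  linarith

variable {κ : Type*} [Fintype κ] [Nonempty κ] {ε t : ℝ}

theorem equiQuad_sqrt (hε : 0 < ε) (ht : 0 ≤ t) (y : κ → ℝ) :
    equiQuad √ε √(ε + Fintype.card κ * t) y =
      (2 * ε)⁻¹ * (∑ i, y i ^ 2 - t / (ε + Fintype.card κ * t) * (∑ i, y i) ^ 2) := by
  have hk : (0 : ℝ) < Fintype.card κ := by exact_mod_cast Fintype.card_pos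
  rw [equiQuad, Real.sq_sqrt hε.le, Real.sq_sqrt (by positivity)]
  have : ε + Fintype.card κ * t ≠ 0 := by positivity
  congr 3
  field_simp
  ring

variable [DecidableEq κ]

theorem integral_pairProd_mul_exp_neg_equiQuad (hε : 0 < ε) (ht : 0 ≤ t) (m : κ → ℝ) {s : Sym2 κ}
    (hs : ¬ s.IsDiag) :
    ∫ x, pairProd (fun i => x i - m i) s *
        Real.exp (-equiQuad √ε √(ε + Fintype.card κ * t) (x - m)) =
      equiNorm κ √ε √(ε + Fintype.card κ * t) * t := by
  have hk : (0 : ℝ) < Fintype.card κ := by exact_mod_cast Fintype.card_pos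
  induction s using Sym2.ind with
  | _ i j =>
    have hij : i ≠ j := by simpa using hs
    simp_rw [pairProd_mk]
    rw [integral_coord_mul_coord_mul_exp_neg_equiQuad (Real.sqrt_pos.2 hε)
      (Real.sqrt_pos.2 (by positivity)), if_neg hij, Real.sq_sqrt hε.le,
      Real.sq_sqrt (by positivity)]
    congr 1
    field_simp
    ring

theorem integral_sq_mul_exp_neg_equiQuad (hε : 0 < ε) (ht : 0 ≤ t) (m : κ → ℝ) (i : κ) :
    ∫ x, (x i - m i) ^ 2 * Real.exp (-equiQuad √ε √(ε + Fintype.card κ * t) (x - m)) =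
      equiNorm κ √ε √(ε + Fintype.card κ * t) * (t + ε) := by
  have hk : (0 : ℝ) < Fintype.card κ := by exact_mod_cast Fintype.card_pos
  simp_rw [sq]
  rw [integral_coord_mul_coord_mul_exp_neg_equiQuad (Real.sqrt_pos.2 hε)
    (Real.sqrt_pos.2 (by positivity)), if_pos rfl, Real.sq_sqrt hε.le, Real.sq_sqrt (by positivity)]
  congr 1
  field_simp
  ring

/-- Moments and negative entropy of equicorrelated Gaussians with fixed mean. -/
theorem fixedMean_mem_and_legendre (hε : 0 < ε) (ht : 0 ≤ t) (m : κ → ℝ) :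
    let φ : (κ → ℝ) → ({s : Sym2 κ // ¬ s.IsDiag} ⊕ (Σ _ : κ, Unit)) → ℝ := fun x =>
      Sum.elim (fun s => pairProd (fun i => x i - m i) s.1) fun p => (x p.1 - m p.1) ^ 2
    Sum.elim (fun _ => t) (fun _ => t + ε) ∈ ExpFamily.meanDomain volume φ ∧
      ExpFamily.legendre volume φ (Sum.elim (fun _ => t) (fun _ => t + ε)) =
        -(1 / 2) * Real.log (ε + Fintype.card κ * t) + equiConst κ ε := by
  intro φ
  have hk : (0 : ℝ) < Fintype.card κ := by exact_mod_cast Fintype.card_pos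
  -- Coefficients of the expanded exponent; each pair occurs twice in (∑ y)², which turns (2 ε)⁻¹
  -- into ε⁻¹.
  refine equicorrelated_mem_and_legendre (θ := Sum.elim
    (fun _ => ε⁻¹ * (t / (ε + Fintype.card κ * t)))
    (fun _ => -((2 * ε)⁻¹ * (1 - t / (ε + Fintype.card κ * t))))) ?_ m ?_ hε ht ?_ ?_
  · rintro (s | ⟨i, j⟩)
    · exact measurable_pairProd (fun i => by fun_prop) s.1
    · simp only [φ, Sum.elim_inr]
      fun_prop
  · rintro (s | ⟨i, j⟩) x
    · exact (abs_pairProd_le _ s.2).trans (by linarith)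
    · exact sq_le_one_add_sum_sq (fun i => x i - m i) i
  · intro x
    rw [equiQuad_sqrt hε ht]
    simp only [Pi.sub_apply]
    rw [sq_sum_eq_sum_pairProd]
    simp only [φ, Fintype.sum_sum_type, Sum.elim_inl, Sum.elim_inr, Fintype.sum_sigma,
      ← Finset.mul_sum, Finset.univ_unique, Finset.sum_singleton]
    field_simp
    ring
  · rintro (s | ⟨i, j⟩)
    · exact integral_pairProd_mul_exp_neg_equiQuad hε ht m s.2
    · exact integral_sq_mul_exp_neg_equiQuad hε ht m i

/-- Moments and negative entropy of centred equicorrelated Gaussians. -/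
theorem gaussian_mem_and_legendre (hε : 0 < ε) (ht : 0 ≤ t) :
    let φ : (κ → ℝ) → ({s : Sym2 κ // ¬ s.IsDiag} ⊕ (Σ _ : κ, Fin 2)) → ℝ := fun x =>
      Sum.elim (fun s => pairProd x s.1) fun p => ![x p.1, x p.1 ^ 2] p.2
    Sum.elim (fun _ => t) (fun p => ![0, t + ε] p.2) ∈ ExpFamily.meanDomain volume φ ∧
      ExpFamily.legendre volume φ (Sum.elim (fun _ => t) (fun p => ![0, t + ε] p.2)) =
        -(1 / 2) * Real.log (ε + Fintype.card κ * t) + equiConst κ ε := by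
  intro φ
  have hk : (0 : ℝ) < Fintype.card κ := by exact_mod_cast Fintype.card_pos
  -- The law is centred, so the statistics x_i get coefficient 0.
  refine equicorrelated_mem_and_legendre (θ := Sum.elim
    (fun _ => ε⁻¹ * (t / (ε + Fintype.card κ * t)))
    (fun p => ![0, -((2 * ε)⁻¹ * (1 - t / (ε + Fintype.card κ * t)))] p.2)) ?_ 0 ?_ hε ht ?_ ?_
  · rintro (s | ⟨i, j⟩)
    · exact measurable_pairProd (fun i => by fun_prop) s.1
    · fin_cases j <;> simp [φ] <;> fun_prop
  · rintro (s | ⟨i, j⟩) x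
    · have := abs_pairProd_le x s.2
      simp only [φ, Sum.elim_inl, Pi.zero_apply, sub_zero]
      linarith
    · have h := sq_le_one_add_sum_sq x i
      rw [abs_of_nonneg (sq_nonneg _)] at h
      have hle : x i ^ 2 ≤ ∑ i, x i ^ 2 :=
        Finset.single_le_sum (f := fun i => x i ^ 2) (fun i _ => sq_nonneg _) (Finset.mem_univ i)
      fin_cases j
      · simp [φ]
        rw [abs_le]
        constructor <;> nlinarith [sq_nonneg (x i - 1), sq_nonneg (x i + 1)]
      · simpa [φ] using h
  · intro x
    rw [equiQuad_sqrt hε ht, sub_zero, sq_sum_eq_sum_pairProd]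
    simp only [φ, Fintype.sum_sum_type, Sum.elim_inl, Sum.elim_inr, Fintype.sum_sigma,
      ← Finset.mul_sum, Fin.sum_univ_two, Matrix.cons_val_zero, Matrix.cons_val_one, zero_mul,
      zero_add]
    field_simp
    ring
  · rintro (s | ⟨i, j⟩)
    · simpa [φ] using integral_pairProd_mul_exp_neg_equiQuad hε ht 0 s.2
    · fin_cases j
      · simpa [φ] using integral_coord_mul_exp_neg_equiQuad (Real.sqrt_pos.2 hε)
          (Real.sqrt_pos.2 (by positivity : 0 < ε + Fintype.card κ * t)) 0 i
      · simpa [φ] using integral_sq_mul_exp_neg_equiQuad hε ht 0 i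

end PairMoments

/-! ### The nullity bound for the Gaussian families -/

variable {V : Type u} [Fintype V] [DecidableEq V] {H : FinHypergraph V}

/-- All variances are t + ε and all covariances t, so the local laws agree at every vertex and
depend affinely on t ∈ [1, 3]. -/
theorem nullity_le_one_of_fixedMeanGaussian (hH : H.Connected) (m : V → ℝ)
    {θbar : ∀ α : H.edges, (fixedMeanGaussian H m).Idx α → ℝ}
    (h : IsConvexFunOn (fixedMeanGaussian H m).L ((fixedMeanGaussian H m).bethe θbar)) :
    H.nullity ≤ 1 := by
  have hne : ∀ α : H.edges, Nonempty α.1 := fun α => (H.nonempty_of_mem α.1 α.2).coe_sort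
  have hF : ∀ (α : H.edges) {ε t : ℝ} (_ : 0 < ε) (_ : 0 ≤ t), _ := fun α ε t hε ht =>
    fixedMean_mem_and_legendre (κ := α.1) hε ht fun i => m i
  have hV : ∀ (i : V) (v : ℝ) (_ : 0 < v), (fun _ : Unit => v) ∈ ExpFamily.meanDomain volume
      (fun x (_ : Unit) => (x - m i) ^ 2) ∧ ExpFamily.legendre volume
      (fun x (_ : Unit) => (x - m i) ^ 2) (fun _ => v) =
        -(1 / 2) * Real.log v - (1 / 2 + Real.log √(2 * Real.pi)) := fun i v hv =>
    gaussianReal_mem_and_legendre (fun _ => by fun_prop) (m i)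
      (fun _ x => by rw [abs_of_nonneg (sq_nonneg _)]; linarith) hv
      (θ := fun _ => -(2 * v)⁻¹) (fun x => by simp) fun _ => by
        rw [integral_sq_sub_mul_gaussianPDFReal (by simpa using hv), Real.coe_toNNReal v hv.le]
  refine LocalFamily.nullity_le_one_of_path hH h
    (η := fun ε t => (fun α => Sum.elim (fun _ => t) (fun _ => t + ε), fun i _ => t + ε))
    ?_ (by norm_num : (1 : ℝ) ≤ 3) ?_
    (A := fun α ε t => -(1 / 2) * Real.log (ε + Fintype.card α.1 * t) + equiConst α.1 ε)
    -- The factor 1 presents a vertex as the case k = 1 of `tendsto_second_difference_log`.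
    (B := fun i ε t => -(1 / 2) * Real.log (ε + 1 * t) + -(1 / 2 + Real.log √(2 * Real.pi)))
    (fun α δ hδ r hr => (hF α hδ.1 (by linarith [hr.1])).2)
    (fun i δ hδ r hr => ?_) log_three_sub_log_two_neg
    (fun α => tendsto_second_difference_log (by exact_mod_cast Fintype.card_pos) _)
    (fun i => tendsto_second_difference_log one_pos _)
  · intro δ s t a b hab
    obtain rfl : b = 1 - a := by linarith
    refine Prod.ext ?_ ?_
    · funext α k
      rcases k with k | k <;>
      simp only [Prod.fst_add, Prod.smul_fst, Pi.add_apply, Pi.smul_apply, smul_eq_mul,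
        Sum.elim_inl, Sum.elim_inr] <;> ring
    · funext i j
      simp only [Prod.snd_add, Prod.smul_snd, Pi.add_apply, Pi.smul_apply, smul_eq_mul]
      ring
  · exact fun δ hδ r hr => ⟨fun α => (hF α hδ.1 (by linarith [hr.1])).1,
      fun i => (hV i (r + δ) (by linarith [hr.1, hδ.1])).1, fun α i j => rfl⟩
  · refine (hV i (r + δ) (by linarith [hr.1, hδ.1])).2.trans ?_
    rw [one_mul, add_comm r δ]
    ring

/-- The same covariances, with all means held at 0: the second moments stay affine in t. -/
theorem nullity_le_one_of_gaussian (hH : H.Connected)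
    {θbar : ∀ α : H.edges, (gaussian H).Idx α → ℝ}
    (h : IsConvexFunOn (gaussian H).L ((gaussian H).bethe θbar)) : H.nullity ≤ 1 := by
  have hne : ∀ α : H.edges, Nonempty α.1 := fun α => (H.nonempty_of_mem α.1 α.2).coe_sort
  have hF : ∀ (α : H.edges) {ε t : ℝ} (_ : 0 < ε) (_ : 0 ≤ t), _ := fun α ε t hε ht =>
    gaussian_mem_and_legendre (κ := α.1) hε ht
  have hV : ∀ (v : ℝ) (_ : 0 < v), ![0, v] ∈ ExpFamily.meanDomain volume
      (fun x : ℝ => ![x, x ^ 2]) ∧ ExpFamily.legendre volume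
      (fun x : ℝ => ![x, x ^ 2]) ![0, v] =
        -(1 / 2) * Real.log v - (1 / 2 + Real.log √(2 * Real.pi)) := fun v hv => by
    have hv' : v.toNNReal ≠ 0 := by simpa using hv
    refine gaussianReal_mem_and_legendre ?_ 0 ?_ hv (θ := ![0, -(2 * v)⁻¹]) ?_ ?_
    · intro j
      fin_cases j <;> simp <;> fun_prop
    · intro j x
      fin_cases j
      · simp
        rw [abs_le]
        constructor <;> nlinarith [sq_nonneg (x - 1), sq_nonneg (x + 1)]
      · simp
    · intro x
      simp [Fin.sum_univ_two]
    · intro j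
      fin_cases j
      · simpa using integral_mul_gaussianPDFReal hv' 0
      · have := integral_sq_sub_mul_gaussianPDFReal hv' 0
        rw [Real.coe_toNNReal v hv.le] at this
        simpa using this
  refine LocalFamily.nullity_le_one_of_path hH h
    (η := fun ε t => (fun α => Sum.elim (fun _ => t) (fun p => ![0, t + ε] p.2),
      fun i => ![0, t + ε]))
    ?_ (by norm_num : (1 : ℝ) ≤ 3) ?_
    (A := fun α ε t => -(1 / 2) * Real.log (ε + Fintype.card α.1 * t) + equiConst α.1 ε)
    (B := fun i ε t => -(1 / 2) * Real.log (ε + 1 * t) + -(1 / 2 + Real.log √(2 * Real.pi)))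
    (fun α δ hδ r hr => (hF α hδ.1 (by linarith [hr.1])).2)
    (fun i δ hδ r hr => ?_) log_three_sub_log_two_neg
    (fun α => tendsto_second_difference_log (by exact_mod_cast Fintype.card_pos) _)
    (fun i => tendsto_second_difference_log one_pos _)
  · intro δ s t a b hab
    obtain rfl : b = 1 - a := by linarith
    have hvec : ∀ j : Fin 2, (![0, a * s + (1 - a) * t + δ] : Fin 2 → ℝ) j =
        a * (![0, s + δ] : Fin 2 → ℝ) j + (1 - a) * (![0, t + δ] : Fin 2 → ℝ) j := fun j => by
      fin_cases j
      · simp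
      · simp
        ring
    refine Prod.ext ?_ ?_
    · funext α k
      rcases k with k | k
      · simp only [Prod.fst_add, Prod.smul_fst, Pi.add_apply, Pi.smul_apply, smul_eq_mul,
          Sum.elim_inl]
      · exact hvec k.2
    · funext i j
      exact hvec j
  · exact fun δ hδ r hr => ⟨fun α => (hF α hδ.1 (by linarith [hr.1])).1,
      fun i => (hV (r + δ) (by linarith [hr.1, hδ.1])).1, fun α i j => rfl⟩
  · refine (hV (r + δ) (by linarith [hr.1, hδ.1])).2.trans ?_
    rw [one_mul, add_comm r δ]
    ring

end

end BetheHyper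

theorem theorem6 {V : Type*} [Fintype V] [DecidableEq V] (H : BetheHyper.FinHypergraph V)
    (hH : H.Connected) :
    -- (i) every inference family, every choice of compatibility functions
    (∀ (X : V → Type*) [∀ i, MeasurableSpace (X i)] (I : BetheHyper.LocalFamily H X),
      I.IsInferenceFamily → (H.nullity = 0 ∨ H.nullity = 1) →
        ∀ θbar, BetheHyper.IsConvexFunOn I.L (I.bethe θbar)) ∧
    -- (ii) multinomial
    (∀ (X : V → Type*) [∀ i, MeasurableSpace (X i)] [∀ i, MeasurableSingletonClass (X i)]
      [∀ i, Finite (X i)] [∀ i, Nontrivial (X i)] (I : BetheHyper.LocalFamily H X),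
      I.IsMultinomial → ∀ θbar, BetheHyper.IsConvexFunOn I.L (I.bethe θbar) →
        (H.nullity = 0 ∨ H.nullity = 1)) ∧
    -- (ii) Gaussian
    (∀ θbar, BetheHyper.IsConvexFunOn (BetheHyper.gaussian H).L
        ((BetheHyper.gaussian H).bethe θbar) →
      (H.nullity = 0 ∨ H.nullity = 1)) ∧
    -- (ii) fixed-mean Gaussian
    (∀ (m : V → ℝ) (θbar), BetheHyper.IsConvexFunOn (BetheHyper.fixedMeanGaussian H m).L
        ((BetheHyper.fixedMeanGaussian H m).bethe θbar) →
      (H.nullity = 0 ∨ H.nullity = 1)) := by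
  refine ⟨fun X _ I hI hn θbar => ?_, fun X _ _ _ _ I hI θbar h => ?_, fun θbar h => ?_,
    fun m θbar h => ?_⟩
  · exact BetheHyper.LocalFamily.bethe_convex hI hH (by omega) θbar
  · exact BetheHyper.FinHypergraph.nullity_eq_zero_or_one_of_le hH
      (BetheHyper.LocalFamily.nullity_le_one_of_isMultinomial hH hI h)
  · exact BetheHyper.FinHypergraph.nullity_eq_zero_or_one_of_le hH
      (BetheHyper.nullity_le_one_of_gaussian hH h)
  · exact BetheHyper.FinHypergraph.nullity_eq_zero_or_one_of_le hH
      (BetheHyper.nullity_le_one_of_fixedMeanGaussian hH m h)
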